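/- Let $\Lambda=\mathbb{Z}_L\times\mathbb{Z}_L$, $L\ge 1$, be the periodic square lattice with a finite-dimensional Hilbert space $\mathcal H_u=\mathbb{C}^{d_u}$ at every site $u$, and let $\mathcal H=\bigotimes_{u\in\Lambda}\mathcal H_u$. For $1\le r\le L$ let $\mathcal S(r)$ be the set of all $r\times r$ square blocks $A\subseteq\Lambda$ (with periodic boundary conditions, so that $\mathcal S(L)=\{\Lambda\}$), and let $\mathcal S(r)=\emptyset$ for $r>L$. A local decomposition of an operator $V$ on $\mathcal H$ is a family of operators $V_{r,A}$, $r\ge1$, $A\in\mathcal S(r)$, such that $V_{r,A}$ has support on $A$ (that is, it is an operator on $\bigotimes_{u\in A}\mathcal H_u$ tensored with the identity) and $V=\sum_{r\ge1}\sum_{A\in\mathcal S(r)}V_{r,A}$. The operator $V$ is called $(J,\mu,\alpha)$-decaying if it has a local decomposition with $$\|V_{r,A}\|\,r^{\alpha}e^{\mu r}\le J\qquad\text{for all } r\ge 1,\ A\in\mathcal S(r).$$ **Lemma.** For every $K_0$ there is a constant $c>0$, depending only on $K_0$ (and not on $L$, the dimensions $d_u$, $\mu$, $\alpha$, $\beta$,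 $J$, $K$, $S$ or $V$), such that the following holds. Let $\mu\ge0$, $\alpha,\beta\ge6$ and $K\le K_0$, let $S$ be an anti-hermitian operator on $\mathcal H$ that is $(K,\mu,\alpha)$-decaying, and let $V$ be an operator on $\mathcal H$ that is $(J,\mu,\beta)$-decaying. Then $$\omega(V)=e^{S}Ve^{-S}-V-[S,V]$$ is $(cJK^2,\mu/2,-1)$-decaying, that is, it has a local decomposition with terms $\Omega_{r,A}$, $A\in\mathcal S(r)$, satisfying $\|\Omega_{r,A}\|\le cJK^2\,r\,e^{-\mu r/2}$. -/

import Mathlib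

/-- The sites of the periodic square lattice `ℤ_L × ℤ_L`. -/
abbrev Site (L : ℕ) : Type := ZMod L × ZMod L

/-- The Hilbert space `⨂_u ℂ^{d u}` of the lattice, written in its product basis, which is labelled
by the configurations `σ = (σ_u)_u` with `σ_u ∈ Fin (d u)`. -/
abbrev QuditSpace {L : ℕ} [NeZero L] (d : Site L → ℕ) : Type :=
  EuclideanSpace ℂ ((u : Site L) → Fin (d u))

/-- Operators on the lattice Hilbert space, with the operator norm; `star` is the adjoint. -/
abbrev QuditOp {L : ℕ} [NeZero L] (d : Site L → ℕ) : Type :=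
  QuditSpace d →L[ℂ] QuditSpace d

/-- The `r × r` block of sites with lower left corner `x` (with periodic boundary conditions). -/
def squareAt (L r : ℕ) (x : Site L) : Finset (Site L) :=
  (Finset.range r ×ˢ Finset.range r).image
    (fun p : ℕ × ℕ => (x.1 + (p.1 : ZMod L), x.2 + (p.2 : ZMod L)))

/-- The set `𝒮(r)` of all `r × r` squares of the lattice; it is empty for `r > L`, and `𝒮(L)`
consists of the whole lattice only. -/
def squares (L r : ℕ) [NeZero L] : Finset (Finset (Site L)) :=
  if 1 ≤ r ∧ r ≤ L then Finset.univ.image (squareAt L r) else ∅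

open Classical in
/-- The matrix of `Y ⊗ I` in the product basis, for an operator on the qudits of `A` with matrix `Y`
and the identity `I` on all qudits outside `A`. -/
noncomputable def tensorIdentity {L : ℕ} [NeZero L] (d : Site L → ℕ) (A : Finset (Site L))
    (Y : Matrix ((u : A) → Fin (d u)) ((u : A) → Fin (d u)) ℂ) :
    Matrix ((u : Site L) → Fin (d u)) ((u : Site L) → Fin (d u)) ℂ :=
  fun σ τ => if ∀ u, u ∉ A → σ u = τ u then Y (fun u => σ u) (fun u => τ u) else 0

/-- `X` has support on `A` (acts on the sites of `A` only): `X = Y ⊗ I` with `Y` acting on `A`. -/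
def SupportedOn {L : ℕ} [NeZero L] {d : Site L → ℕ} (A : Finset (Site L)) (X : QuditOp d) : Prop :=
  ∃ Y : Matrix ((u : A) → Fin (d u)) ((u : A) → Fin (d u)) ℂ,
    X = Matrix.toEuclideanCLM (𝕜 := ℂ) (tensorIdentity d A Y)

/-- `T` is a local decomposition of `V`: `T r A` has support on `A` for every `A ∈ 𝒮(r)`, `r ≥ 1`,
and `V = ∑_{r ≥ 1} ∑_{A ∈ 𝒮(r)} T r A`, where only `r ≤ L` contributes as `𝒮(r) = ∅` for `r > L`. -/
def IsLocalDecomposition {L : ℕ} [NeZero L] {d : Site L → ℕ} (V : QuditOp d)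
    (T : ℕ → Finset (Site L) → QuditOp d) : Prop :=
  (∀ r, 1 ≤ r → ∀ A ∈ squares L r, SupportedOn A (T r A)) ∧
    V = ∑ r ∈ Finset.Icc 1 L, ∑ A ∈ squares L r, T r A

/-- The family `T` of local terms is `(J, μ, α)`-decaying. -/
def IsDecayingFamily {L : ℕ} [NeZero L] {d : Site L → ℕ} (T : ℕ → Finset (Site L) → QuditOp d)
    (J μ α : ℝ) : Prop :=
  ∀ r : ℕ, 1 ≤ r → ∀ A ∈ squares L r, ‖T r A‖ * (r : ℝ) ^ α * Real.exp (μ * r) ≤ J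

/-- The operator `V` is `(J, μ, α)`-decaying: it has a `(J, μ, α)`-decaying local decomposition. -/
def IsDecaying {L : ℕ} [NeZero L] {d : Site L → ℕ} (V : QuditOp d) (J μ α : ℝ) : Prop :=
  ∃ T : ℕ → Finset (Site L) → QuditOp d, IsLocalDecomposition V T ∧ IsDecayingFamily T J μ α

/-- `ω(V) = e^S V e^{-S} - V - [S, V]`. -/
noncomputable def secondOrder {L : ℕ} [NeZero L] {d : Site L → ℕ} (S V : QuditOp d) : QuditOp d :=
  NormedSpace.exp S * V * NormedSpace.exp (-S) - V - (S * V - V * S)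

/-!
The operator `V` is a sum of terms `W a A`, and `ω` is linear in `V`. For one such term, let `S_n` be
the sum of those terms of `S` whose squares lie in the enlargement of `A` by `n - 1` sites on each
side. Then `ω_S(W a A)` is the telescoping sum of the differences
`ω_{S_{n+1}}(W a A) - ω_{S_n}(W a A)`, and the `n`-th one is supported on the enlargement of `A` by `n`
sites, a square of size `a + 2n` or the whole lattice. Collecting these differences
(`layerTerm`) according to their supporting squares (`layerSquare`) gives the local decomposition.

The size of a difference is a locality (Lieb–Robinson) estimate, which has to hold for generators of
any strength `K`, so that the commutator series cannot be summed term by term. Instead, for a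
term `S_i` of size `s`, the difference `y_i(t)` of its evolutions under `S_{n+1}` and `S_n` satisfies
`y_i(t) ≤ 2‖S_i‖ ∫₀ᵗ ∑_j (‖S_j‖ or y_j)`, the sum being over the terms `j` that overlap `i` and with
`‖S_j‖` for those missing in `S_n` (`norm_conjExp_sub_conjExp_le`, `norm_evolution_sub_le`). Such a
system of inequalities is dominated by any superharmonic weight `h` with `h ≥ 1` on the missing terms
(`norm_evolution_term_sub_le`). The weight `h = s² e^{-μl} / (1 + l)` works, where `l` is the depth of
the square inside the enlarged region: a term of size `s'` is overlapped by at most `s'² s²` squares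
of size `s`, the factor `s⁻⁶` leaves `s⁻²` after multiplication with `h`, and
`∑ s⁻² / (1 + (l - s)) = O(1 / (1 + l))` (`sum_inv_sq_mul_inv_le`, `sum_termDecay_mul_weight_le`).

Differentiating `ω_{tS}` once reduces the second-order estimate to these first-order ones
(`norm_remainder_sub_remainder_le`), and the `n`-th difference is `O(J K² a⁻² e^{-μ(a+n)} / (1 + n))`.
Since `a + n` is at least half the size of the supporting square, this gives the rate `μ/2`. It remains
to count layers with the same support (`sum_layer_fiber_le`): at most one for each `a` if the square
is smaller than the lattice, and at most `L²` for each `a` on the whole lattice, where the sum of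
`a⁻² / (1 + n)` over `a + 2n ≥ L` is `O(1 / L)`.
-/

set_option linter.unusedSectionVars false

open NormedSpace

/-! ### Comparing two unitary evolutions -/

section Abstract

variable {𝔸 : Type*} [NormedRing 𝔸] [StarRing 𝔸] [CStarRing 𝔸] [NormedAlgebra ℝ 𝔸]
  [CompleteSpace 𝔸] [StarModule ℝ 𝔸]

/-- The evolution `e^{tS} X e^{-tS}` of `X` generated by `S`, at time `t`. -/
noncomputable def conjExp (t : ℝ) (S X : 𝔸) : 𝔸 := exp (t • S) * X * exp (-(t • S))

lemma exp_real_smul_mul_neg (t : ℝ) (S : 𝔸) : exp (t • S) * exp (-(t • S)) = 1 := by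
  let _ : NormedAlgebra ℚ 𝔸 := NormedAlgebra.restrictScalars ℚ ℝ 𝔸
  rw [← exp_add_of_commute (Commute.refl _).neg_right, add_neg_cancel, exp_zero]

lemma exp_neg_mul_real_smul (t : ℝ) (S : 𝔸) : exp (-(t • S)) * exp (t • S) = 1 := by
  have := exp_real_smul_mul_neg t (-S)
  simpa using this

lemma exp_real_smul_mem_unitary {S : 𝔸} (hS : star S = -S) (t : ℝ) :
    exp (t • S) ∈ unitary 𝔸 := by
  let _ : NormedAlgebra ℚ 𝔸 := NormedAlgebra.restrictScalars ℚ ℝ 𝔸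
  refine exp_mem_unitary_of_mem_skewAdjoint ?_
  rw [skewAdjoint.mem_iff, star_smul, hS, smul_neg]; simp

lemma exp_neg_real_smul_mem_unitary {S : 𝔸} (hS : star S = -S) (t : ℝ) :
    exp (-(t • S)) ∈ unitary 𝔸 := by
  have := exp_real_smul_mem_unitary hS (-t)
  rwa [neg_smul] at this

lemma norm_conjExp {S : 𝔸} (hS : star S = -S) (t : ℝ) (X : 𝔸) : ‖conjExp t S X‖ = ‖X‖ := by
  rw [conjExp, CStarRing.norm_mul_mem_unitary _ (exp_neg_real_smul_mem_unitary hS t),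
    CStarRing.norm_mem_unitary_mul _ (exp_real_smul_mem_unitary hS t)]

lemma conjExp_mul (t : ℝ) (S X Y : 𝔸) : conjExp t S (X * Y) = conjExp t S X * conjExp t S Y := by
  simp only [conjExp]
  calc _ = exp (t • S) * X * 1 * Y * exp (-(t • S)) := by noncomm_ring
    _ = _ := by rw [← exp_neg_mul_real_smul t S]; noncomm_ring

lemma conjExp_sub (t : ℝ) (S X Y : 𝔸) : conjExp t S (X - Y) = conjExp t S X - conjExp t S Y := by
  simp only [conjExp, mul_sub, sub_mul]

lemma conjExp_add (t : ℝ) (S X Y : 𝔸) : conjExp t S (X + Y) = conjExp t S X + conjExp t S Y := by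
  simp only [conjExp, mul_add, add_mul]

lemma conjExp_sum {ι : Type*} (t : ℝ) (S : 𝔸) (s : Finset ι) (X : ι → 𝔸) :
    conjExp t S (∑ i ∈ s, X i) = ∑ i ∈ s, conjExp t S (X i) := by
  simp only [conjExp, Finset.mul_sum, Finset.sum_mul]

lemma conjExp_zero_left (S X : 𝔸) : conjExp 0 S X = X := by simp [conjExp]

lemma conjExp_zero (t : ℝ) (X : 𝔸) : conjExp t 0 X = X := by simp [conjExp]

lemma hasDerivAt_exp_neg_smul' (S : 𝔸) (t : ℝ) :
    HasDerivAt (fun u : ℝ => exp (-(u • S))) (-S * exp (-(t • S))) t := by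
  have := hasDerivAt_exp_smul_const' (𝕂 := ℝ) (-S) t
  simpa only [smul_neg] using this

lemma hasDerivAt_conjExp (S X : 𝔸) (t : ℝ) :
    HasDerivAt (fun u => conjExp u S X) (conjExp t S (S * X - X * S)) t := by
  have h := ((hasDerivAt_exp_smul_const (𝕂 := ℝ) S t).mul_const X).mul (hasDerivAt_exp_neg_smul' S t)
  refine h.congr_deriv ?_
  simp only [conjExp]; noncomm_ring

lemma norm_mul_sub_mul_le (X Y : 𝔸) : ‖X * Y - Y * X‖ ≤ 2 * ‖X‖ * ‖Y‖ := by
  calc _ ≤ ‖X * Y‖ + ‖Y * X‖ := norm_sub_le _ _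
    _ ≤ ‖X‖ * ‖Y‖ + ‖Y‖ * ‖X‖ := add_le_add (norm_mul_le _ _) (norm_mul_le _ _)
    _ = _ := by ring

/-- If only the part `D₀` of `S₀` and the part `D₁` of `S₁` fail to commute with `X`, then the two
evolutions of `X` differ by at most `2‖X‖` times the time integral `b` of the difference of the
evolutions of `D₀` and `D₁`. Up to unitary factors the difference is the commutator of `X` with
`Q_t = e^{t(S₀-D₀)} e^{-tS₀} e^{tS₁} e^{-t(S₁-D₁)}`, and `Q_t - 1` is controlled by its derivative.
This replaces the usual commutator form of the Lieb–Robinson argument. -/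
lemma norm_conjExp_sub_conjExp_le {S₀ S₁ D₀ D₁ X : 𝔸} {b b' : ℝ → ℝ}
    (hS₀ : star S₀ = -S₀) (hS₁ : star S₁ = -S₁) (hD₀ : star D₀ = -D₀) (hD₁ : star D₁ = -D₁)
    (h₀ : Commute (S₀ - D₀) X) (h₁ : Commute (S₁ - D₁) X)
    (hb0 : 0 ≤ b 0) (hb : ∀ t, HasDerivAt b (b' t) t)
    (hbound : ∀ t ∈ Set.Icc (0 : ℝ) 1, ‖conjExp t S₀ D₀ - conjExp t S₁ D₁‖ ≤ b' t)
    {t : ℝ} (ht : t ∈ Set.Icc (0 : ℝ) 1) :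
    ‖conjExp t S₀ X - conjExp t S₁ X‖ ≤ 2 * ‖X‖ * b t := by
  set C₀ := S₀ - D₀ with hC₀
  set C₁ := S₁ - D₁ with hC₁
  have hC₀s : star C₀ = -C₀ := by rw [hC₀, star_sub, hS₀, hD₀]; abel
  have hC₁s : star C₁ = -C₁ := by rw [hC₁, star_sub, hS₁, hD₁]; abel
  -- commuting factors are stripped off on the outside, so that only `D₀` and `D₁` survive in `Q'`
  let Q : ℝ → 𝔸 := fun u =>
    (exp (u • C₀) * exp (-(u • S₀))) * (exp (u • S₁) * exp (-(u • C₁)))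
  have hQ : ∀ u, HasDerivAt Q (-((exp (u • C₀) * exp (-(u • S₀))) *
      (conjExp u S₀ D₀ - conjExp u S₁ D₁) * (exp (u • S₁) * exp (-(u • C₁))))) u := by
    intro u
    have h := ((hasDerivAt_exp_smul_const (𝕂 := ℝ) C₀ u).mul (hasDerivAt_exp_neg_smul' S₀ u)).mul
      ((hasDerivAt_exp_smul_const (𝕂 := ℝ) S₁ u).mul (hasDerivAt_exp_neg_smul' C₁ u))
    refine h.congr_deriv ?_
    have e₀ : exp (-(u • S₀)) * conjExp u S₀ D₀ = D₀ * exp (-(u • S₀)) := by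
      simp only [conjExp, ← mul_assoc, exp_neg_mul_real_smul, one_mul]
    have e₁ : conjExp u S₁ D₁ * exp (u • S₁) = exp (u • S₁) * D₁ := by
      simp only [conjExp, mul_assoc, exp_neg_mul_real_smul, mul_one]
    calc _ = -(exp (u • C₀) * (D₀ * exp (-(u • S₀))) * (exp (u • S₁) * exp (-(u • C₁))) -
          (exp (u • C₀) * exp (-(u • S₀))) * ((exp (u • S₁) * D₁) * exp (-(u • C₁)))) := by
            have d₀ : D₀ = S₀ - C₀ := by rw [hC₀]; abel
            have d₁ : D₁ = S₁ - C₁ := by rw [hC₁]; abel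
            clear_value C₀ C₁
            simp only [Pi.mul_apply, d₀, d₁]
            noncomm_ring
      _ = _ := by rw [← e₀, ← e₁]; noncomm_ring
  have hQ1 : ‖Q t - 1‖ ≤ b t := by
    refine image_norm_le_of_norm_deriv_right_le_deriv_boundary (f := fun u => Q u - 1)
      (a := 0) (b := 1) (B := b) (B' := b')
      (fun u _ => ((hQ u).sub_const 1).continuousAt.continuousWithinAt)
      (fun u _ => ((hQ u).sub_const 1).hasDerivWithinAt) (by simpa [Q] using hb0) hb ?_ ht
    intro u hu
    rw [norm_neg, ← mul_assoc, CStarRing.norm_mul_mem_unitary _ (exp_neg_real_smul_mem_unitary hC₁s u),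
      CStarRing.norm_mul_mem_unitary _ (exp_real_smul_mem_unitary hS₁ u), mul_assoc,
      CStarRing.norm_mem_unitary_mul _ (exp_real_smul_mem_unitary hC₀s u),
      CStarRing.norm_mem_unitary_mul _ (exp_neg_real_smul_mem_unitary hS₀ u)]
    exact hbound u ⟨hu.1, hu.2.le⟩
  have c₀ : exp (t • C₀) * X = X * exp (t • C₀) := by
    let _ : NormedAlgebra ℚ 𝔸 := NormedAlgebra.restrictScalars ℚ ℝ 𝔸
    exact ((h₀.smul_left t).exp_left).eq
  have c₁ : X * exp (-(t • C₁)) = exp (-(t • C₁)) * X := by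
    let _ : NormedAlgebra ℚ 𝔸 := NormedAlgebra.restrictScalars ℚ ℝ 𝔸
    exact (((h₁.smul_left t).neg_left).exp_left).eq.symm
  have key : exp (t • C₀) * exp (-(t • S₀)) * (conjExp t S₀ X - conjExp t S₁ X) * exp (t • S₁) *
      exp (-(t • C₁)) = X * Q t - Q t * X := by
    have e₀ : exp (-(t • S₀)) * conjExp t S₀ X = X * exp (-(t • S₀)) := by
      simp only [conjExp, ← mul_assoc, exp_neg_mul_real_smul, one_mul]
    have e₁ : conjExp t S₁ X * exp (t • S₁) = exp (t • S₁) * X := by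
      simp only [conjExp, mul_assoc, exp_neg_mul_real_smul, mul_one]
    calc _ = exp (t • C₀) * (exp (-(t • S₀)) * conjExp t S₀ X) * exp (t • S₁) * exp (-(t • C₁)) -
          exp (t • C₀) * exp (-(t • S₀)) * (conjExp t S₁ X * exp (t • S₁)) * exp (-(t • C₁)) := by
            noncomm_ring
      _ = (exp (t • C₀) * X) * exp (-(t • S₀)) * exp (t • S₁) * exp (-(t • C₁)) -
          exp (t • C₀) * exp (-(t • S₀)) * exp (t • S₁) * (X * exp (-(t • C₁))) := by
            rw [e₀, e₁]; noncomm_ring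
      _ = _ := by rw [c₀, c₁]; simp only [Q]; noncomm_ring
  have hnorm : ‖conjExp t S₀ X - conjExp t S₁ X‖ = ‖X * Q t - Q t * X‖ := by
    rw [← key, CStarRing.norm_mul_mem_unitary _ (exp_neg_real_smul_mem_unitary hC₁s t),
      CStarRing.norm_mul_mem_unitary _ (exp_real_smul_mem_unitary hS₁ t), mul_assoc,
      CStarRing.norm_mem_unitary_mul _ (exp_real_smul_mem_unitary hC₀s t),
      CStarRing.norm_mem_unitary_mul _ (exp_neg_real_smul_mem_unitary hS₀ t)]
  rw [hnorm]
  calc ‖X * Q t - Q t * X‖ = ‖X * (Q t - 1) - (Q t - 1) * X‖ := by congr 1; noncomm_ring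
    _ ≤ 2 * ‖X‖ * ‖Q t - 1‖ := norm_mul_sub_mul_le _ _
    _ ≤ _ := by gcongr

/-! ### Locality of evolutions generated by sums of local terms -/

section Family

variable {ι : Type*} [DecidableEq ι] {I I' : Finset ι} {S : ι → 𝔸}

lemma star_sum_eq_neg_of_skew (hS : ∀ i ∈ I, star (S i) = -S i) {N : Finset ι} (hN : N ⊆ I) :
    star (∑ i ∈ N, S i) = -∑ i ∈ N, S i := by
  rw [star_sum, ← Finset.sum_neg_distrib]
  exact Finset.sum_congr rfl fun i hi => hS i (hN hi)

/-- The comparison of evolutions for the generators `∑ i ∈ I, S i` and `∑ i ∈ I', S i`, where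
`N` contains all terms that fail to commute with `X`. -/
lemma norm_evolution_sub_le (hI' : I' ⊆ I) (hS : ∀ i ∈ I, star (S i) = -S i)
    {N : Finset ι} (hN : N ⊆ I) {X : 𝔸} (hX : ∀ i ∈ I, i ∉ N → Commute (S i) X)
    {b b' : ℝ → ℝ} (hb0 : 0 ≤ b 0) (hb : ∀ t, HasDerivAt b (b' t) t)
    (hbound : ∀ t ∈ Set.Icc (0 : ℝ) 1, ∑ i ∈ N \ I', ‖S i‖ + ∑ i ∈ N ∩ I',
      ‖conjExp t (∑ i ∈ I, S i) (S i) - conjExp t (∑ i ∈ I', S i) (S i)‖ ≤ b' t)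
    {t : ℝ} (ht : t ∈ Set.Icc (0 : ℝ) 1) :
    ‖conjExp t (∑ i ∈ I, S i) X - conjExp t (∑ i ∈ I', S i) X‖ ≤ 2 * ‖X‖ * b t := by
  have hs := star_sum_eq_neg_of_skew hS subset_rfl
  refine norm_conjExp_sub_conjExp_le (D₀ := ∑ i ∈ N, S i) (D₁ := ∑ i ∈ N ∩ I', S i)
    hs (star_sum_eq_neg_of_skew hS hI') (star_sum_eq_neg_of_skew hS hN)
    (star_sum_eq_neg_of_skew hS (Finset.inter_subset_left.trans hN)) ?_ ?_ hb0 hb ?_ ht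
  · rw [← Finset.sum_sdiff hN, add_sub_cancel_right]
    refine Commute.sum_left _ _ _ fun i hi => ?_
    rw [Finset.mem_sdiff] at hi
    exact hX i hi.1 hi.2
  · rw [← Finset.sum_sdiff (Finset.inter_subset_right : N ∩ I' ⊆ I'), add_sub_cancel_right]
    refine Commute.sum_left _ _ _ fun i hi => ?_
    rw [Finset.mem_sdiff, Finset.mem_inter] at hi
    exact hX i (hI' hi.1) fun h => hi.2 ⟨h, hi.1⟩
  · intro u hu
    refine le_trans ?_ (hbound u hu)
    rw [← Finset.sum_inter_add_sum_sdiff N I' S, add_comm, conjExp_add, conjExp_sum, conjExp_sum,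
      conjExp_sum, add_sub_assoc, ← Finset.sum_sub_distrib]
    refine (norm_add_le _ _).trans (add_le_add ((norm_sum_le _ _).trans ?_) (norm_sum_le _ _))
    exact Finset.sum_le_sum fun i _ => (norm_conjExp hs u _).le

/-- One step of the Picard iteration: the bounds `k i * h i * A t` for the evolved terms `S i` of the
generator give the bound `‖X‖ * g * B t` for any `X` with weight `g`, where `B' = 2c(1 + A)`. The
summand `1` accounts for the terms outside `I'`, on which the weight `h` is at least `1`. -/
lemma norm_evolution_sub_le_step (hI' : I' ⊆ I) (hS : ∀ i ∈ I, star (S i) = -S i)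
    {k h : ι → ℝ} (hk : ∀ i ∈ I, ‖S i‖ ≤ k i) (hh : ∀ i ∈ I, 0 ≤ h i)
    (hh1 : ∀ i ∈ I, i ∉ I' → 1 ≤ h i)
    {N : Finset ι} (hN : N ⊆ I) {X : 𝔸} (hX : ∀ i ∈ I, i ∉ N → Commute (S i) X)
    {c g : ℝ} (hg : ∑ i ∈ N, k i * h i ≤ c * g)
    {A B : ℝ → ℝ} (hA0 : ∀ t ∈ Set.Icc (0 : ℝ) 1, 0 ≤ A t) (hB0 : 0 ≤ g * B 0)
    (hB : ∀ t, HasDerivAt B (2 * c * (1 + A t)) t)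
    (hA : ∀ t ∈ Set.Icc (0 : ℝ) 1, ∀ i ∈ I,
      ‖conjExp t (∑ i ∈ I, S i) (S i) - conjExp t (∑ i ∈ I', S i) (S i)‖ ≤ k i * h i * A t)
    {t : ℝ} (ht : t ∈ Set.Icc (0 : ℝ) 1) :
    ‖conjExp t (∑ i ∈ I, S i) X - conjExp t (∑ i ∈ I', S i) X‖ ≤ ‖X‖ * g * B t := by
  have hk0 : ∀ i ∈ I, 0 ≤ k i := fun i hi => (norm_nonneg _).trans (hk i hi)
  have := norm_evolution_sub_le (b := fun t => g * B t / 2) (b' := fun t => c * g * (1 + A t))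
    hI' hS hN hX (by linarith) (fun t => (((hB t).const_mul g).div_const 2).congr_deriv (by ring))
    ?_ ht
  · exact this.trans (le_of_eq (by ring))
  intro u hu
  calc _ ≤ ∑ i ∈ N \ I', k i * h i * (1 + A u) + ∑ i ∈ N ∩ I', k i * h i * (1 + A u) := by
        gcongr with i hi i hi
        · rw [Finset.mem_sdiff] at hi
          have h1 := hh1 i (hN hi.1) hi.2
          calc ‖S i‖ ≤ k i * 1 * 1 := by simpa using hk i (hN hi.1)
            _ ≤ _ := by
              have := hk0 i (hN hi.1)
              have := hA0 u hu
              gcongr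
              linarith
        · have hi' := hN (Finset.mem_inter.1 hi).1
          refine (hA u hu i hi').trans ?_
          have := mul_nonneg (hk0 i hi') (hh i hi')
          gcongr; linarith
    _ = (∑ i ∈ N, k i * h i) * (1 + A u) := by
        rw [add_comm, Finset.sum_inter_add_sum_sdiff, Finset.sum_mul]
    _ ≤ _ := by
        have := hA0 u hu
        gcongr

/-- Locality of the evolution: if the positive weight `h` is superharmonic for the neighbourhood
structure `N`, in the sense that `∑ j ∈ N i, k j * h j ≤ c * h i`, then removing the terms outside
`I'` from the generator changes the evolved term `S i` by at most `k i * h i * (e^{2ct} - 1)`. The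
estimate holds for every size of the generator because the trivial bound `2‖S i‖` is iterated
and the Picard remainder `(2ct)^n / n!` tends to zero. -/
lemma norm_evolution_term_sub_le (hI' : I' ⊆ I) (hS : ∀ i ∈ I, star (S i) = -S i)
    {k h : ι → ℝ} (hk : ∀ i ∈ I, ‖S i‖ ≤ k i) (hh : ∀ i ∈ I, 0 < h i)
    (hh1 : ∀ i ∈ I, i ∉ I' → 1 ≤ h i)
    {N : ι → Finset ι} (hN : ∀ i ∈ I, N i ⊆ I)
    (hNc : ∀ i ∈ I, ∀ j ∈ I, j ∉ N i → Commute (S j) (S i))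
    {c : ℝ} (hc : 0 ≤ c) (hg : ∀ i ∈ I, ∑ j ∈ N i, k j * h j ≤ c * h i)
    {t : ℝ} (ht : t ∈ Set.Icc (0 : ℝ) 1) {i : ι} (hi : i ∈ I) :
    ‖conjExp t (∑ i ∈ I, S i) (S i) - conjExp t (∑ i ∈ I', S i) (S i)‖ ≤
      k i * h i * (Real.exp (2 * c * t) - 1) := by
  have hk0 : ∀ i ∈ I, 0 ≤ k i := fun i hi => (norm_nonneg _).trans (hk i hi)
  -- `R` is so large that the trivial bound `2 * k i` is at most `k i * h i * R` for every `i`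
  set R : ℝ := ∑ i ∈ I, 2 / h i with hR
  have hR0 : 0 ≤ R := Finset.sum_nonneg fun i hi => by have := hh i hi; positivity
  let A : ℕ → ℝ → ℝ := fun n t => Real.exp (2 * c * t) - 1 + R * ((2 * c * t) ^ n / n.factorial)
  have hA : ∀ n, ∀ t ∈ Set.Icc (0 : ℝ) 1, 0 ≤ A n t := by
    intro n t ht
    have h1 : 0 ≤ 2 * c * t := mul_nonneg (by linarith) ht.1
    have := Real.one_le_exp h1
    have h2 : 0 ≤ R * ((2 * c * t) ^ n / n.factorial) := by positivity
    simp only [A]; linarith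
  have key : ∀ n, ∀ t ∈ Set.Icc (0 : ℝ) 1, ∀ i ∈ I,
      ‖conjExp t (∑ i ∈ I, S i) (S i) - conjExp t (∑ i ∈ I', S i) (S i)‖ ≤ k i * h i * A n t := by
    intro n
    induction n with
    | zero =>
      intro t ht i hi
      have h1 : 1 ≤ Real.exp (2 * c * t) := Real.one_le_exp (mul_nonneg (by linarith) ht.1)
      have h2 : 2 / h i ≤ R := Finset.single_le_sum (f := fun i => 2 / h i)
        (fun i hi => by have := hh i hi; positivity) hi
      have h3 : 2 ≤ h i * A 0 t := by
        have := hh i hi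
        calc (2 : ℝ) = h i * (2 / h i) := by field_simp
          _ ≤ _ := by
            gcongr
            simp only [A]; simp; linarith
      calc _ ≤ ‖S i‖ + ‖S i‖ := by
            refine (norm_sub_le _ _).trans (le_of_eq ?_)
            rw [norm_conjExp (star_sum_eq_neg_of_skew hS subset_rfl),
              norm_conjExp (star_sum_eq_neg_of_skew hS hI')]
        _ ≤ k i * 2 := by linarith [hk i hi]
        _ ≤ _ := by
          rw [mul_assoc]
          exact mul_le_mul_of_nonneg_left h3 (hk0 i hi)
    | succ n ih =>
      intro t ht i hi
      refine (norm_evolution_sub_le_step (B := A (n + 1)) hI' hS hk (fun i hi => (hh i hi).le) hh1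
        (hN i hi) (hNc i hi) (hg i hi) (hA n) (mul_nonneg (hh i hi).le (hA (n + 1) 0 (by simp)))
        ?_ ih ht).trans ?_
      · intro u
        have hl : HasDerivAt (fun u : ℝ => 2 * c * u) (2 * c) u := by
          simpa using (hasDerivAt_id u).const_mul (2 * c)
        have := (hl.exp.sub_const 1).add (((hl.pow (n + 1)).div_const
          ((n + 1).factorial : ℝ)).const_mul R)
        refine this.congr_deriv ?_
        have : ((n + 1).factorial : ℝ) = (n + 1) * n.factorial := by
          rw [Nat.factorial_succ]; push_cast; ring
        rw [this]
        have : (n.factorial : ℝ) ≠ 0 := by positivity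
        simp only [A, Nat.add_sub_cancel]
        push_cast
        field_simp
        ring
      · have := hA (n + 1) t ht
        have := (hh i hi).le
        have := hk i hi
        gcongr
  have hlim : Filter.Tendsto (fun n => k i * h i * A n t) Filter.atTop
      (nhds (k i * h i * (Real.exp (2 * c * t) - 1 + R * 0))) :=
    (((FloorSemiring.tendsto_pow_div_factorial_atTop (2 * c * t)).const_mul R).const_add
      _).const_mul _
  rw [mul_zero, add_zero] at hlim
  exact ge_of_tendsto' hlim fun n => key n t ht i hi

lemma norm_evolution_sub_self_le (hS : ∀ i ∈ I, star (S i) = -S i)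
    {k : ι → ℝ} (hk : ∀ i ∈ I, ‖S i‖ ≤ k i)
    {N : Finset ι} (hN : N ⊆ I) {X : 𝔸} (hX : ∀ i ∈ I, i ∉ N → Commute (S i) X)
    {t : ℝ} (ht : t ∈ Set.Icc (0 : ℝ) 1) :
    ‖conjExp t (∑ i ∈ I, S i) X - X‖ ≤ 2 * ‖X‖ * ∑ i ∈ N, k i := by
  have h := norm_evolution_sub_le (I' := ∅) (b := fun t => t * ∑ i ∈ N, k i)
    (b' := fun _ => ∑ i ∈ N, k i)
    (Finset.empty_subset _) hS hN hX (by simp)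
    (fun t => by simpa using (hasDerivAt_id t).mul_const (∑ i ∈ N, k i)) (fun u _ => by
      simpa using Finset.sum_le_sum fun i hi => hk i (hN hi)) ht
  rw [Finset.sum_empty, conjExp_zero] at h
  refine h.trans ?_
  have : 0 ≤ ∑ i ∈ N, k i := Finset.sum_nonneg fun i hi => (norm_nonneg _).trans (hk i (hN hi))
  gcongr
  exact mul_le_of_le_one_left this ht.2

/-- The second-order remainder `e^S V e^{-S} - V - [S, V]`. -/
noncomputable def remainder (S V : 𝔸) : 𝔸 := exp S * V * exp (-S) - V - (S * V - V * S)

lemma remainder_eq (S V : 𝔸) : remainder S V = conjExp 1 S V - V - (S * V - V * S) := by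
  simp [remainder, conjExp]

lemma conjExp_commutator (t : ℝ) (S X Y : 𝔸) : conjExp t S (X * Y - Y * X) =
    conjExp t S X * conjExp t S Y - conjExp t S Y * conjExp t S X := by
  rw [conjExp_sub, conjExp_mul, conjExp_mul]

lemma norm_commutator_sub_commutator_le (X Y X' Y' : 𝔸) :
    ‖(X * Y - Y * X) - (X' * Y' - Y' * X')‖ ≤ 2 * ‖X - X'‖ * ‖Y‖ + 2 * ‖X'‖ * ‖Y - Y'‖ := by
  calc _ = ‖((X - X') * Y - Y * (X - X')) + (X' * (Y - Y') - (Y - Y') * X')‖ := by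
        congr 1; noncomm_ring
    _ ≤ _ := (norm_add_le _ _).trans
      (add_le_add (norm_mul_sub_mul_le _ _) (norm_mul_sub_mul_le _ _))

lemma sum_commutator_eq {N : Finset ι} (hN : N ⊆ I) {X : 𝔸}
    (hX : ∀ i ∈ I, i ∉ N → Commute (S i) X) :
    (∑ i ∈ I, S i) * X - X * (∑ i ∈ I, S i) = ∑ i ∈ N, (S i * X - X * S i) := by
  rw [Finset.sum_mul, Finset.mul_sum, ← Finset.sum_sub_distrib]
  refine (Finset.sum_subset hN fun i hi hiN => ?_).symm
  rw [(hX i hi hiN).eq, sub_self]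

/-- Locality of the second-order remainder: removing the terms outside `I'` from the generator
changes it by a multiple of the weight `q` of `V`, with a constant of second order in the strength
`c` of the generator. The weight `m` (resp. `p` for `V`) measures the total strength of the
neighbours. -/
theorem norm_remainder_sub_remainder_le (hI' : I' ⊆ I) (hS : ∀ i ∈ I, star (S i) = -S i)
    {k h m : ι → ℝ} (hk : ∀ i ∈ I, ‖S i‖ ≤ k i) (hh : ∀ i ∈ I, 0 < h i)
    (hm1 : ∀ i ∈ I, 1 ≤ m i) (hmh : ∀ i ∈ I, i ∉ I' → m i ≤ h i)
    {N : ι → Finset ι} (hN : ∀ i ∈ I, N i ⊆ I)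
    (hNc : ∀ i ∈ I, ∀ j ∈ I, j ∉ N i → Commute (S j) (S i))
    {c : ℝ} (hc : 0 ≤ c) (hg : ∀ i ∈ I, ∑ j ∈ N i, k j * h j ≤ c * h i)
    (hgm : ∀ i ∈ I, ∑ j ∈ N i, k j ≤ c * m i)
    {M : Finset ι} (hM : M ⊆ I) {V : 𝔸} (hV : ∀ i ∈ I, i ∉ M → Commute (S i) V)
    {p q : ℝ} (hp : 1 ≤ p) (hq : 0 ≤ q) (hMp : ∑ j ∈ M, k j ≤ c * p)
    (hMq : ∑ j ∈ M, k j * h j ≤ c * q) :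
    ‖remainder (∑ i ∈ I, S i) V - remainder (∑ i ∈ I', S i) V‖ ≤
      6 * ‖V‖ * (2 * c + (Real.exp (2 * c) - 1)) * c * p * q := by
  have hk0 : ∀ i ∈ I, 0 ≤ k i := fun i hi => (norm_nonneg _).trans (hk i hi)
  have hh1 : ∀ i ∈ I, i ∉ I' → 1 ≤ h i := fun i hi hi' => (hm1 i hi).trans (hmh i hi hi')
  set T := ∑ i ∈ I, S i with hT
  set T' := ∑ i ∈ I', S i with hT'
  have hTs : star T = -T := star_sum_eq_neg_of_skew hS subset_rfl
  have hTs' : star T' = -T' := star_sum_eq_neg_of_skew hS hI'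
  set e := Real.exp (2 * c) - 1 with he
  have he0 : 0 ≤ e := by have := Real.one_le_exp (x := 2 * c) (by linarith); linarith
  have hexp : ∀ t ∈ Set.Icc (0 : ℝ) 1, Real.exp (2 * c * t) - 1 ≤ e := by
    intro t ht
    have : 2 * c * t ≤ 2 * c := mul_le_of_le_one_right (by linarith) ht.2
    have := Real.exp_le_exp.2 this
    linarith
  -- first-order estimates for the terms of the generator and for `V`
  have hterm : ∀ t ∈ Set.Icc (0 : ℝ) 1, ∀ i ∈ I,
      ‖conjExp t T (S i) - conjExp t T' (S i)‖ ≤ k i * h i * e := fun t ht i hi =>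
    (norm_evolution_term_sub_le hI' hS hk hh hh1 hN hNc hc hg ht hi).trans
      (mul_le_mul_of_nonneg_left (hexp t ht) (mul_nonneg (hk0 i hi) (hh i hi).le))
  have hVd : ∀ t ∈ Set.Icc (0 : ℝ) 1,
      ‖conjExp t T V - conjExp t T' V‖ ≤ ‖V‖ * q * e := by
    intro t ht
    refine (norm_evolution_sub_le_step (A := fun t => Real.exp (2 * c * t) - 1)
      (B := fun t => Real.exp (2 * c * t) - 1) hI' hS hk
      (fun i hi => (hh i hi).le) hh1 hM hV hMq ?_ (by simp) ?_ ?_ ht).trans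
      (mul_le_mul_of_nonneg_left (hexp t ht) (by positivity))
    · intro u hu
      have := Real.one_le_exp (x := 2 * c * u) (mul_nonneg (by linarith) hu.1)
      linarith
    · intro u
      have hl : HasDerivAt (fun u : ℝ => 2 * c * u) (2 * c) u := by
        simpa using (hasDerivAt_id u).const_mul (2 * c)
      exact (hl.exp.sub_const 1).congr_deriv (by ring)
    · intro u hu i hi
      exact norm_evolution_term_sub_le hI' hS hk hh hh1 hN hNc hc hg hu hi
  have hterm1 : ∀ t ∈ Set.Icc (0 : ℝ) 1, ∀ i ∈ I,
      ‖conjExp t T (S i) - S i‖ ≤ 2 * k i * (c * m i) := by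
    intro t ht i hi
    have h1 := hk i hi
    have h2 := hgm i hi
    have h3 := hk0 i hi
    have h4 : 0 ≤ ∑ j ∈ N i, k j := Finset.sum_nonneg fun j hj => hk0 j (hN i hi hj)
    refine (norm_evolution_sub_self_le hS hk (hN i hi) (hNc i hi) ht).trans ?_
    gcongr
  have hV1 : ∀ t ∈ Set.Icc (0 : ℝ) 1, ‖conjExp t T V - V‖ ≤ 2 * ‖V‖ * (c * p) := by
    intro t ht
    refine (norm_evolution_sub_self_le hS hk hM hV ht).trans ?_
    gcongr
  -- the difference of the remainders of `tS`, whose derivative only involves evolved commutators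
  let G : ℝ → 𝔸 := fun t => conjExp t T V - conjExp t T' V -
    t • ((T * V - V * T) - (T' * V - V * T'))
  let W : ι → 𝔸 := fun i => S i * V - V * S i
  have hTW : T * V - V * T = ∑ i ∈ M \ I', W i + ∑ i ∈ M ∩ I', W i := by
    rw [add_comm, Finset.sum_inter_add_sum_sdiff]
    exact sum_commutator_eq hM hV
  have hTW' : T' * V - V * T' = ∑ i ∈ M ∩ I', W i :=
    sum_commutator_eq Finset.inter_subset_right fun i hi hiM => hV i (hI' hi) fun h =>
      hiM (Finset.mem_inter.2 ⟨h, hi⟩)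
  have hG : ∀ t, HasDerivAt G (∑ i ∈ M \ I', (conjExp t T (W i) - W i) +
      ∑ i ∈ M ∩ I', (conjExp t T (W i) - conjExp t T' (W i))) t := by
    intro t
    have := ((hasDerivAt_conjExp T V t).sub (hasDerivAt_conjExp T' V t)).sub
      ((hasDerivAt_id t).smul_const ((T * V - V * T) - (T' * V - V * T')))
    refine this.congr_deriv ?_
    rw [one_smul, hTW, hTW', conjExp_add, conjExp_sum, conjExp_sum, conjExp_sum,
      Finset.sum_sub_distrib (fun i => conjExp t T (W i)) W,
      Finset.sum_sub_distrib (fun i => conjExp t T (W i)) (fun i => conjExp t T' (W i))]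
    abel
  have hbound : ∀ t ∈ Set.Ico (0 : ℝ) 1, ‖∑ i ∈ M \ I', (conjExp t T (W i) - W i) +
      ∑ i ∈ M ∩ I', (conjExp t T (W i) - conjExp t T' (W i))‖ ≤
      6 * ‖V‖ * (2 * c + e) * c * p * q := by
    intro t ht'
    have ht : t ∈ Set.Icc (0 : ℝ) 1 := ⟨ht'.1, ht'.2.le⟩
    have hp0 : 0 ≤ p := by linarith
    set F : ι → ℝ := fun i =>
      2 * ‖V‖ * (2 * c + e) * (k i * h i + p * (k i * h i) + k i * q) with hF
    -- terms missing in `I'`: the evolution moves `[S i, V]` by an amount of first order in `c`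
    have hout : ∀ i ∈ M \ I', ‖conjExp t T (W i) - W i‖ ≤ F i := by
      intro i hi
      rw [Finset.mem_sdiff] at hi
      have hiI := hM hi.1
      have h1 := hm1 i hiI
      have h2 := hmh i hiI hi.2
      have h3 := hk0 i hiI
      simp only [W]
      rw [conjExp_commutator]
      refine (norm_commutator_sub_commutator_le _ _ _ _).trans ?_
      rw [norm_conjExp hTs]
      calc _ ≤ 2 * (2 * k i * (c * m i)) * ‖V‖ + 2 * k i * (2 * ‖V‖ * (c * p)) := by
            gcongr
            · exact hterm1 t ht i hiI
            · exact hk i hiI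
            · exact hV1 t ht
        _ = 2 * ‖V‖ * (2 * c) * (k i * m i + p * (k i * 1)) := by ring
        _ ≤ 2 * ‖V‖ * (2 * c + e) * (k i * h i + p * (k i * h i) + k i * q) := by
            have hkq : 0 ≤ k i * q := by positivity
            have hle : k i * m i + p * (k i * 1) ≤ k i * h i + p * (k i * h i) := by
              gcongr
              linarith
            have h5 : 2 * c ≤ 2 * c + e := by linarith
            have h6 : 0 ≤ k i * m i + p * (k i * 1) := by positivity
            exact mul_le_mul (mul_le_mul_of_nonneg_left h5 (by positivity))
              (hle.trans (le_add_of_nonneg_right hkq)) h6 (by positivity)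
    -- terms in `I'`: the two evolutions of `[S i, V]` are compared factor by factor
    have hin : ∀ i ∈ M ∩ I', ‖conjExp t T (W i) - conjExp t T' (W i)‖ ≤ F i := by
      intro i hi
      rw [Finset.mem_inter] at hi
      have hiI := hM hi.1
      have h3 := hk0 i hiI
      have h4 := (hh i hiI).le
      simp only [W]
      rw [conjExp_commutator, conjExp_commutator]
      refine (norm_commutator_sub_commutator_le _ _ _ _).trans ?_
      rw [norm_conjExp hTs, norm_conjExp hTs']
      calc _ ≤ 2 * (k i * h i * e) * ‖V‖ + 2 * k i * (‖V‖ * q * e) := by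
            gcongr
            · exact hterm t ht i hiI
            · exact hk i hiI
            · exact hVd t ht
        _ = 2 * ‖V‖ * e * (k i * h i + k i * q) := by ring
        _ ≤ 2 * ‖V‖ * (2 * c + e) * (k i * h i + p * (k i * h i) + k i * q) := by
            have : 0 ≤ p * (k i * h i) := by positivity
            gcongr <;> linarith
    calc _ ≤ ∑ i ∈ M \ I', F i + ∑ i ∈ M ∩ I', F i :=
          (norm_add_le _ _).trans (add_le_add
            ((norm_sum_le _ _).trans (Finset.sum_le_sum hout))
            ((norm_sum_le _ _).trans (Finset.sum_le_sum hin)))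
      _ = ∑ i ∈ M, F i := by rw [add_comm, Finset.sum_inter_add_sum_sdiff]
      _ = 2 * ‖V‖ * (2 * c + e) * (∑ i ∈ M, k i * h i + p * ∑ i ∈ M, k i * h i +
            (∑ i ∈ M, k i) * q) := by
          simp only [hF, ← Finset.mul_sum, Finset.sum_add_distrib, ← Finset.sum_mul]
      _ ≤ 2 * ‖V‖ * (2 * c + e) * (p * (c * q) + p * (c * q) + (c * p) * q) := by
          have : ∑ i ∈ M, k i * h i ≤ p * (c * q) :=
            hMq.trans (le_mul_of_one_le_left (by positivity) hp)
          gcongr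
      _ = _ := by ring
  have := norm_image_sub_le_of_norm_deriv_le_segment_01' (f := G)
    (fun t _ => (hG t).hasDerivWithinAt) hbound
  refine le_trans (le_of_eq ?_) this
  rw [remainder_eq, remainder_eq]
  simp only [G, conjExp_zero_left]
  congr 1
  rw [one_smul, zero_smul]
  abel

end Family
end Abstract

/-! ### Operators supported on a set of sites -/

section Support

lemma exp_mem_of_isClosed {𝔸 : Type*} [NormedRing 𝔸] [NormedAlgebra ℂ 𝔸] [StarRing 𝔸]
    [StarModule ℂ 𝔸] {s : StarSubalgebra ℂ 𝔸} (hs : IsClosed (s : Set 𝔸)) {x : 𝔸} (h : x ∈ s) :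
    exp x ∈ s := by
  let _ : Algebra ℚ 𝔸 := Algebra.compHom _ (algebraMap ℚ ℂ)
  have : IsScalarTower ℚ ℂ 𝔸 := ⟨fun q z X => by rw [Algebra.smul_def q z, mul_smul]; rfl⟩
  exact exp_mem (R := ℂ) hs h

variable {L : ℕ} [NeZero L] {d : Site L → ℕ}

open Classical in
/-- A configuration of the lattice as a pair of configurations, on `A` and outside `A`. -/
noncomputable def configSplit (d : Site L → ℕ) (A : Finset (Site L)) :
    ((u : Site L) → Fin (d u)) ≃
      ((u : A) → Fin (d u)) × ((u : {u : Site L // u ∉ A}) → Fin (d u)) :=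
  Equiv.piEquivPiSubtypeProd (fun u => u ∈ A) (fun u => Fin (d u))

open Classical in
lemma tensorIdentity_eq_submatrix (A : Finset (Site L))
    (Y : Matrix ((u : A) → Fin (d u)) ((u : A) → Fin (d u)) ℂ) :
    tensorIdentity d A Y = (Matrix.kroneckerMap (· * ·) Y 1).submatrix
      (configSplit d A) (configSplit d A) := by
  ext σ τ
  have : (∀ u, u ∉ A → σ u = τ u) ↔ (configSplit d A σ).2 = (configSplit d A τ).2 := by
    rw [funext_iff]
    exact ⟨fun h u => h u u.2, fun h u hu => h ⟨u, hu⟩⟩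
  rw [tensorIdentity, Matrix.submatrix_apply, Matrix.kroneckerMap_apply, Matrix.one_apply]
  simp only [this, mul_ite, mul_one, mul_zero]
  rfl

open Classical in
/-- The embedding `Y ↦ Y ⊗ I` of the operators on the sites of `A`, as a star-algebra
homomorphism. -/
noncomputable def localEmbedding (d : Site L → ℕ) (A : Finset (Site L)) :
    Matrix ((u : A) → Fin (d u)) ((u : A) → Fin (d u)) ℂ →⋆ₐ[ℂ] QuditOp d :=
  (Matrix.toEuclideanCLM (𝕜 := ℂ) (n := (u : Site L) → Fin (d u))).toStarAlgHom.comp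
    { toFun := tensorIdentity d A
      map_one' := by
        rw [tensorIdentity_eq_submatrix, Matrix.one_kronecker_one, Matrix.submatrix_one_equiv]
      map_mul' := fun X Y => by
        simp only [tensorIdentity_eq_submatrix]
        rw [Matrix.submatrix_mul_equiv, ← Matrix.mul_kronecker_mul, one_mul]
      map_zero' := by ext; simp [tensorIdentity]
      map_add' := fun X Y => by
        simp only [tensorIdentity_eq_submatrix]
        rw [Matrix.add_kronecker]; rfl
      commutes' := fun z => by
        simp only [tensorIdentity_eq_submatrix, Algebra.algebraMap_eq_smul_one]
        rw [Matrix.smul_kronecker, Matrix.one_kronecker_one, Matrix.submatrix_smul]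
        simp
      map_star' := fun X => by
        simp only [tensorIdentity_eq_submatrix, Matrix.star_eq_conjTranspose]
        rw [Matrix.conjTranspose_submatrix, Matrix.conjTranspose_kronecker, Matrix.conjTranspose_one] }

lemma localEmbedding_apply (A : Finset (Site L))
    (Y : Matrix ((u : A) → Fin (d u)) ((u : A) → Fin (d u)) ℂ) :
    localEmbedding d A Y = Matrix.toEuclideanCLM (𝕜 := ℂ) (tensorIdentity d A Y) := rfl

/-- The algebra of all operators supported on `A`. -/
noncomputable def localAlgebra (d : Site L → ℕ) (A : Finset (Site L)) :
    StarSubalgebra ℂ (QuditOp d) := (localEmbedding d A).range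

lemma supportedOn_iff {A : Finset (Site L)} {X : QuditOp d} :
    SupportedOn A X ↔ X ∈ localAlgebra d A :=
  ⟨fun ⟨Y, h⟩ => ⟨Y, h.symm⟩, fun ⟨Y, h⟩ => ⟨Y, h.symm⟩⟩

lemma isClosed_localAlgebra (A : Finset (Site L)) :
    IsClosed (localAlgebra d A : Set (QuditOp d)) := by
  exact Submodule.closed_of_finiteDimensional (Subalgebra.toSubmodule (localAlgebra d A).toSubalgebra)

lemma exp_mem_localAlgebra {A : Finset (Site L)} {X : QuditOp d} (h : X ∈ localAlgebra d A) :
    exp X ∈ localAlgebra d A :=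
  exp_mem_of_isClosed (isClosed_localAlgebra A) h

lemma remainder_mem_localAlgebra {A : Finset (Site L)} {S V : QuditOp d}
    (hS : S ∈ localAlgebra d A) (hV : V ∈ localAlgebra d A) :
    remainder S V ∈ localAlgebra d A :=
  sub_mem (sub_mem (mul_mem (mul_mem (exp_mem_localAlgebra hS) hV)
    (exp_mem_localAlgebra (neg_mem hS))) hV) (sub_mem (mul_mem hS hV) (mul_mem hV hS))

open Classical in
/-- `Y ⊗ I` is unchanged if `Y` is first extended by the identity from `A` to a larger set `B`. -/
lemma tensorIdentity_extend {A B : Finset (Site L)} (hAB : A ⊆ B)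
    (Y : Matrix ((u : A) → Fin (d u)) ((u : A) → Fin (d u)) ℂ) :
    tensorIdentity d B (fun σ τ => if ∀ u : B, (u : Site L) ∉ A → σ u = τ u then
      Y (fun u => σ ⟨u, hAB u.2⟩) (fun u => τ ⟨u, hAB u.2⟩) else 0) = tensorIdentity d A Y := by
  ext σ τ
  simp only [tensorIdentity]
  by_cases h : ∀ u, u ∉ A → σ u = τ u
  · rw [if_pos fun u hu => h u fun hA => hu (hAB hA), if_pos h,
      if_pos (c := ∀ u : B, (u : Site L) ∉ A → σ u = τ u) fun u hu => h u hu]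
  · rw [if_neg h]
    split_ifs with h1 h2
    · refine absurd (fun u hu => ?_) h
      by_cases hB : u ∈ B
      · exact h2 ⟨u, hB⟩ hu
      · exact h1 u hB
    · rfl
    · rfl

open Classical in
lemma localAlgebra_mono {A B : Finset (Site L)} (hAB : A ⊆ B) :
    localAlgebra d A ≤ localAlgebra d B := by
  rintro X ⟨Y, rfl⟩
  exact ⟨fun σ τ => if ∀ u : B, (u : Site L) ∉ A → σ u = τ u then
    Y (fun u => σ ⟨u, hAB u.2⟩) (fun u => τ ⟨u, hAB u.2⟩) else 0, (localEmbedding_apply _ _).trans ((congrArg (Matrix.toEuclideanCLM (𝕜 := ℂ))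
      (tensorIdentity_extend hAB Y)).trans (localEmbedding_apply _ _).symm)⟩

open Classical in
/-- The matrix of `Y ⊗ Z ⊗ I` for operators on disjoint sets of sites. In the sum over intermediate
configurations only the one that equals `τ` on `A` and `σ` elsewhere contributes. -/
lemma tensorIdentity_mul_apply {A B : Finset (Site L)} (hAB : Disjoint A B)
    (Y : Matrix ((u : A) → Fin (d u)) ((u : A) → Fin (d u)) ℂ)
    (Z : Matrix ((u : B) → Fin (d u)) ((u : B) → Fin (d u)) ℂ) (σ τ : (u : Site L) → Fin (d u)) :
    (tensorIdentity d A Y * tensorIdentity d B Z) σ τ =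
      if ∀ u, u ∉ A → u ∉ B → σ u = τ u then
        Y (fun u => σ u) (fun u => τ u) * Z (fun u => σ u) (fun u => τ u) else 0 := by
  rw [Matrix.mul_apply, Finset.sum_eq_single (fun u => if u ∈ A then τ u else σ u)]
  · have hB : ∀ u ∈ B, u ∉ A := fun u hu hA => Finset.disjoint_left.1 hAB hA hu
    have e1 : tensorIdentity d A Y σ (fun u => if u ∈ A then τ u else σ u) =
        Y (fun u => σ u) (fun u => τ u) := by
      rw [tensorIdentity, if_pos fun u hu => by rw [if_neg hu]]
      congr 1
      ext u
      rw [if_pos u.2]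
    have e2 : tensorIdentity d B Z (fun u => if u ∈ A then τ u else σ u) τ =
        if ∀ u, u ∉ A → u ∉ B → σ u = τ u then Z (fun u => σ u) (fun u => τ u) else 0 := by
      rw [tensorIdentity]
      refine if_congr ⟨fun h u hA hB => ?_, fun h u hB => ?_⟩ ?_ rfl
      · have := h u hB
        rwa [if_neg hA] at this
      · by_cases hA : u ∈ A
        · rw [if_pos hA]
        · rw [if_neg hA]; exact h u hA hB
      · congr 1
        ext u
        rw [if_neg (hB u u.2)]
    rw [e1, e2, mul_ite, mul_zero]
  · intro ρ _ hρ
    simp only [tensorIdentity]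
    split_ifs with h1 h2
    · refine absurd (funext fun u => ?_) hρ
      by_cases hA : u ∈ A
      · rw [if_pos hA]; exact h2 u (Finset.disjoint_left.1 hAB hA)
      · rw [if_neg hA]; exact (h1 u hA).symm
    all_goals simp
  · intro h; exact absurd (Finset.mem_univ _) h

lemma commute_of_disjoint {A B : Finset (Site L)} (hAB : Disjoint A B) {X Y : QuditOp d}
    (hX : X ∈ localAlgebra d A) (hY : Y ∈ localAlgebra d B) : Commute X Y := by
  obtain ⟨X, rfl⟩ := hX
  obtain ⟨Y, rfl⟩ := hY
  have h : Commute (tensorIdentity d A X) (tensorIdentity d B Y) := by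
    ext σ τ
    rw [tensorIdentity_mul_apply hAB, tensorIdentity_mul_apply hAB.symm]
    refine if_congr ⟨fun h u hB hA => h u hA hB, fun h u hA hB => h u hB hA⟩ (mul_comm _ _) rfl
  exact h.map (Matrix.toEuclideanCLM (𝕜 := ℂ) (n := (u : Site L) → Fin (d u)))

end Support

/-! ### Squares on the periodic lattice -/

section Geometry
variable {L : ℕ}

lemma mem_squareAt {r : ℕ} {x u : Site L} :
    u ∈ squareAt L r x ↔ ∃ p < r, ∃ q < r, u.1 = x.1 + (p : ℕ) ∧ u.2 = x.2 + (q : ℕ) := by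
  simp only [squareAt, Finset.mem_image, Finset.mem_product, Finset.mem_range, Prod.exists,
    Prod.ext_iff]
  exact ⟨fun ⟨p, q, ⟨hp, hq⟩, h1, h2⟩ => ⟨p, hp, q, hq, h1.symm, h2.symm⟩,
    fun ⟨p, hp, q, hq, h1, h2⟩ => ⟨p, q, ⟨hp, hq⟩, h1.symm, h2.symm⟩⟩

lemma card_squareAt_le (r : ℕ) (x : Site L) : (squareAt L r x).card ≤ r ^ 2 := by
  refine Finset.card_image_le.trans ?_
  rw [Finset.card_product, Finset.card_range, sq]

lemma squareAt_eq_univ [NeZero L] {r : ℕ} (hr : L ≤ r) (x : Site L) :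
    squareAt L r x = Finset.univ := by
  refine Finset.eq_univ_of_forall fun u => mem_squareAt.2
    ⟨(u.1 - x.1).val, (ZMod.val_lt _).trans_le hr, (u.2 - x.2).val, (ZMod.val_lt _).trans_le hr, ?_⟩
  simp

/-- An arc shorter than the cycle `ℤ_L` determines its starting point. -/
lemma arc_injective [NeZero L] {r : ℕ} (hr1 : 1 ≤ r) (hr : r < L) {x y : ZMod L}
    (h : ∀ u : ZMod L, (∃ p < r, u = x + (p : ℕ)) ↔ ∃ p < r, u = y + (p : ℕ)) : x = y := by
  obtain ⟨i, hi, hxi⟩ := (h x).1 ⟨0, hr1, by simp⟩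
  rcases Nat.eq_zero_or_pos i with rfl | hi0
  · simpa using hxi
  -- otherwise `x - 1` belongs to the second arc, hence to the first one
  obtain ⟨p, hp, hxp⟩ := (h (x - 1)).2 ⟨i - 1, by omega, by
    rw [Nat.cast_sub hi0, hxi]; push_cast; ring⟩
  have h0 : ((p + 1 : ℕ) : ZMod L) = 0 := by
    push_cast
    linear_combination -hxp
  rw [ZMod.natCast_eq_zero_iff] at h0
  exact absurd (Nat.le_of_dvd (by omega) h0) (by omega)

lemma squareAt_injective [NeZero L] {r : ℕ} (hr1 : 1 ≤ r) (hr : r < L) :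
    Function.Injective (squareAt L r) := by
  intro x y h
  have key : ∀ u : Site L, u ∈ squareAt L r x ↔ u ∈ squareAt L r y := fun u => by rw [h]
  simp only [mem_squareAt] at key
  refine Prod.ext (arc_injective hr1 hr fun u => ⟨?_, ?_⟩) (arc_injective hr1 hr fun u => ⟨?_, ?_⟩)
  · rintro ⟨p, hp, h1⟩
    obtain ⟨p', hp', q', hq', h1', -⟩ := (key (u, x.2)).1 ⟨p, hp, 0, hr1, h1, by simp⟩
    exact ⟨p', hp', h1'⟩
  · rintro ⟨p, hp, h1⟩
    obtain ⟨p', hp', q', hq', h1', -⟩ := (key (u, y.2)).2 ⟨p, hp, 0, hr1, h1, by simp⟩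
    exact ⟨p', hp', h1'⟩
  · rintro ⟨p, hp, h1⟩
    obtain ⟨p', hp', q', hq', -, h1'⟩ := (key (x.1, u)).1 ⟨0, hr1, p, hp, by simp, h1⟩
    exact ⟨q', hq', h1'⟩
  · rintro ⟨p, hp, h1⟩
    obtain ⟨p', hp', q', hq', -, h1'⟩ := (key (y.1, u)).2 ⟨0, hr1, p, hp, by simp, h1⟩
    exact ⟨q', hq', h1'⟩

lemma mem_squares [NeZero L] {r : ℕ} {A : Finset (Site L)} :
    A ∈ squares L r ↔ (1 ≤ r ∧ r ≤ L) ∧ ∃ x, squareAt L r x = A := by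
  unfold squares
  split_ifs with h
  · simp [h]
  · simp [h]

/-- The square obtained from `squareAt L a x` by adding `n` sites on each side. It is the whole
lattice once `L ≤ a + 2n`. -/
def enlargedSquare (L a : ℕ) (x : Site L) (n : ℕ) : Finset (Site L) :=
  squareAt L (a + 2 * n) (x.1 - (n : ZMod L), x.2 - (n : ZMod L))

lemma enlargedSquare_zero (a : ℕ) (x : Site L) : enlargedSquare L a x 0 = squareAt L a x := by
  simp [enlargedSquare]

lemma mem_enlargedSquare_of_mem {a n s : ℕ} {x z u v : Site L}
    (hu : u ∈ enlargedSquare L a x n) (huz : u ∈ squareAt L s z) (hvz : v ∈ squareAt L s z) :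
    v ∈ enlargedSquare L a x (n + s) := by
  obtain ⟨p, hp, q, hq, h1, h2⟩ := mem_squareAt.1 hu
  obtain ⟨p', hp', q', hq', h1', h2'⟩ := mem_squareAt.1 huz
  obtain ⟨p'', hp'', q'', hq'', h1'', h2''⟩ := mem_squareAt.1 hvz
  refine mem_squareAt.2 ⟨p + s + p'' - p', by omega, q + s + q'' - q', by omega, ?_, ?_⟩
  · rw [Nat.cast_sub (by omega)]
    push_cast
    linear_combination h1'' + h1 - h1'
  · rw [Nat.cast_sub (by omega)]
    push_cast
    linear_combination h2'' + h2 - h2'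

lemma enlargedSquare_mono (a : ℕ) (x : Site L) : Monotone (enlargedSquare L a x) := by
  intro n m hnm u hu
  obtain ⟨p, hp, q, hq, h1, h2⟩ := mem_squareAt.1 hu
  refine mem_squareAt.2 ⟨p + (m - n), by omega, q + (m - n), by omega, ?_, ?_⟩
  · rw [Nat.cast_add, Nat.cast_sub hnm, h1]; ring
  · rw [Nat.cast_add, Nat.cast_sub hnm, h2]; ring

lemma enlargedSquare_eq_univ [NeZero L] {a n : ℕ} (x : Site L) (h : L ≤ a + 2 * n) :
    enlargedSquare L a x n = Finset.univ := squareAt_eq_univ h _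

/-- The distance that `Z` reaches away from `squareAt L a x`: the least `n` such that the enlargement
of this square by `n` sites on each side contains `Z`. -/
noncomputable def squareDist (L a : ℕ) (x : Site L) (Z : Finset (Site L)) : ℕ :=
  sInf {n | Z ⊆ enlargedSquare L a x n}

lemma squareDist_le_iff [NeZero L] {a : ℕ} {x : Site L} {Z : Finset (Site L)} {n : ℕ} :
    squareDist L a x Z ≤ n ↔ Z ⊆ enlargedSquare L a x n := by
  refine ⟨fun h => ?_, fun h => Nat.sInf_le h⟩
  have hne : {n | Z ⊆ enlargedSquare L a x n}.Nonempty :=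
    ⟨L, by simp [enlargedSquare_eq_univ (L := L) (a := a) (n := L) x (by omega)]⟩
  exact (Nat.sInf_mem hne).trans (enlargedSquare_mono a x h)

lemma squareDist_squareAt [NeZero L] (a : ℕ) (x : Site L) :
    squareDist L a x (squareAt L a x) = 0 :=
  Nat.le_zero.1 (squareDist_le_iff.2 (enlargedSquare_zero a x).ge)

/-- A square of size `s` that meets `X` reaches at most `s` sites further than `X`. -/
lemma squareDist_le_add [NeZero L] {a s : ℕ} {x : Site L} {X Z : Finset (Site L)}
    (hZ : Z ∈ squares L s) (hXZ : ¬Disjoint Z X) :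
    squareDist L a x Z ≤ squareDist L a x X + s := by
  obtain ⟨-, z, rfl⟩ := mem_squares.1 hZ
  obtain ⟨u, huZ, huX⟩ := Finset.not_disjoint_iff.1 hXZ
  exact squareDist_le_iff.2 fun v hv =>
    mem_enlargedSquare_of_mem (squareDist_le_iff.1 le_rfl huX) huZ hv

open Classical in
/-- Each of the sites of `X` lies in at most `s²` squares of size `s`. -/
lemma card_squares_not_disjoint_le [NeZero L] (s : ℕ) (X : Finset (Site L)) :
    ((squares L s).filter fun Z => ¬Disjoint Z X).card ≤ X.card * s ^ 2 := by
  have hsub : ((squares L s).filter fun Z => ¬Disjoint Z X) ⊆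
      (X ×ˢ (Finset.range s ×ˢ Finset.range s)).image fun w =>
        squareAt L s (w.1.1 - (w.2.1 : ℕ), w.1.2 - (w.2.2 : ℕ)) := by
    intro Z hZ
    rw [Finset.mem_filter] at hZ
    obtain ⟨-, z, rfl⟩ := mem_squares.1 hZ.1
    obtain ⟨u, huZ, huX⟩ := Finset.not_disjoint_iff.1 hZ.2
    obtain ⟨p, hp, q, hq, h1, h2⟩ := mem_squareAt.1 huZ
    refine Finset.mem_image.2 ⟨(u, p, q), ?_, ?_⟩
    · simp [huX, hp, hq]
    · simp [h1, h2]
  refine (Finset.card_le_card hsub).trans (Finset.card_image_le.trans ?_)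
  simp [Finset.card_product, sq]

end Geometry

/-! ### Sums of inverse squares -/

section Sums

lemma sum_inv_sq_le_two (M : ℕ) : ∑ s ∈ Finset.Icc 1 M, ((s : ℝ) ^ 2)⁻¹ ≤ 2 := by
  have := sum_Ioo_inv_sq_le (α := ℝ) 0 (M + 1)
  have e : Finset.Ioo 0 (M + 1) = Finset.Icc 1 M := by ext; simp; omega
  rw [e] at this
  simpa using this

lemma sum_inv_sq_tail_le (l M : ℕ) :
    ∑ s ∈ Finset.Ioc l M, ((s : ℝ) ^ 2)⁻¹ ≤ 2 / (l + 1) := by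
  have := sum_Ioo_inv_sq_le (α := ℝ) l (M + 1)
  have e : Finset.Ioo l (M + 1) = Finset.Ioc l M := by ext; simp
  rwa [e] at this

/-- The weight `1 / (1 + l)` survives convolution with `1 / s²`; truncated subtraction makes the
weight equal to `1` for `s ≥ l`. -/
lemma sum_inv_sq_mul_inv_le (l M : ℕ) :
    ∑ s ∈ Finset.Icc 1 M, ((s : ℝ) ^ 2)⁻¹ * (1 + ((l - s : ℕ) : ℝ))⁻¹ ≤ 6 * (1 + (l : ℝ))⁻¹ := by
  have hl : (0 : ℝ) < 1 + l := by positivity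
  have hsplit : Finset.Icc 1 M ⊆ Finset.Icc 1 l ∪ Finset.Ioc l M := by
    intro s; simp; omega
  have hdisj : Disjoint (Finset.Icc 1 l) (Finset.Ioc l M) := by
    rw [Finset.disjoint_left]; intro s; simp; omega
  refine (Finset.sum_le_sum_of_subset_of_nonneg hsplit fun _ _ _ => by positivity).trans ?_
  rw [Finset.sum_union hdisj]
  have h1 : ∑ s ∈ Finset.Icc 1 l, ((s : ℝ) ^ 2)⁻¹ * (1 + ((l - s : ℕ) : ℝ))⁻¹ ≤
      4 * (1 + (l : ℝ))⁻¹ := by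
    -- with `y = 1 + l - s` one has `(1 + l) / (s² y) = 1 / s² + 1 / (s y)`
    have hterm : ∀ s ∈ Finset.Icc 1 l, ((s : ℝ) ^ 2)⁻¹ * (1 + ((l - s : ℕ) : ℝ))⁻¹ ≤
        (((s : ℝ) ^ 2)⁻¹ + (((s : ℝ) ^ 2)⁻¹ + (((l + 1 - s : ℕ) : ℝ) ^ 2)⁻¹) / 2) *
          (1 + (l : ℝ))⁻¹ := by
      intro s hs
      rw [Finset.mem_Icc] at hs
      have hs0 : (0 : ℝ) < s := by exact_mod_cast hs.1
      have e1 : (1 + ((l - s : ℕ) : ℝ)) = 1 + l - s := by rw [Nat.cast_sub hs.2]; ring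
      have e2 : ((l + 1 - s : ℕ) : ℝ) = 1 + l - s := by
        rw [Nat.cast_sub (by omega)]; push_cast; ring
      rw [e1, e2]
      have hsl : (s : ℝ) ≤ l := by exact_mod_cast hs.2
      obtain ⟨y, hy⟩ : ∃ y : ℝ, y = 1 + l - s := ⟨_, rfl⟩
      have hy0 : 0 < y := by linarith
      have hly : (1 + (l : ℝ)) = y + s := by linarith
      rw [← hy, ← div_eq_mul_inv _ (1 + (l : ℝ)), le_div_iff₀ hl, hly]
      have e3 : ((s : ℝ) ^ 2)⁻¹ * y⁻¹ * (y + s) = ((s : ℝ) ^ 2)⁻¹ + (s : ℝ)⁻¹ * y⁻¹ := by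
        field_simp
      rw [e3, ← inv_pow, ← inv_pow]
      nlinarith [sq_nonneg ((s : ℝ)⁻¹ - y⁻¹)]
    have hrefl : ∑ s ∈ Finset.Icc 1 l, (((l + 1 - s : ℕ) : ℝ) ^ 2)⁻¹ =
        ∑ s ∈ Finset.Icc 1 l, ((s : ℝ) ^ 2)⁻¹ := by
      refine Finset.sum_nbij' (fun s => l + 1 - s) (fun s => l + 1 - s) ?_ ?_ ?_ ?_ ?_ <;>
        simp <;> omega
    refine (Finset.sum_le_sum hterm).trans ?_
    rw [← Finset.sum_mul, Finset.sum_add_distrib, ← Finset.sum_div, Finset.sum_add_distrib, hrefl]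
    have := sum_inv_sq_le_two l
    gcongr
    linarith
  have h2 : ∑ s ∈ Finset.Ioc l M, ((s : ℝ) ^ 2)⁻¹ * (1 + ((l - s : ℕ) : ℝ))⁻¹ ≤
      2 * (1 + (l : ℝ))⁻¹ := by
    calc _ ≤ ∑ s ∈ Finset.Ioc l M, ((s : ℝ) ^ 2)⁻¹ := by
          refine Finset.sum_le_sum fun s hs => ?_
          refine mul_le_of_le_one_right (by positivity) (inv_le_one_of_one_le₀ ?_)
          linarith [Nat.cast_nonneg (α := ℝ) (l - s)]
      _ ≤ _ := (sum_inv_sq_tail_le l M).trans (le_of_eq (by rw [div_eq_mul_inv, add_comm]))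
  linarith

end Sums

/-! ### Adding generator terms layer by layer around a square -/

section Local
variable {L : ℕ} [NeZero L]

/-- All pairs `(r, A)` with `A ∈ 𝒮(r)`. -/
def squareIndex (L : ℕ) [NeZero L] : Finset (Σ _ : ℕ, Finset (Site L)) :=
  (Finset.Icc 1 L).sigma fun r => squares L r

lemma mem_squareIndex {i : Σ _ : ℕ, Finset (Site L)} :
    i ∈ squareIndex L ↔ (1 ≤ i.1 ∧ i.1 ≤ L) ∧ i.2 ∈ squares L i.1 := by
  rw [squareIndex, Finset.mem_sigma, Finset.mem_Icc]

lemma card_le_sq_of_mem_squareIndex {i : Σ _ : ℕ, Finset (Site L)} (hi : i ∈ squareIndex L) :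
    i.2.card ≤ i.1 ^ 2 := by
  obtain ⟨-, x, hx⟩ := mem_squares.1 (mem_squareIndex.1 hi).2
  rw [← hx]
  exact card_squareAt_le _ _

open Classical in
lemma sum_squareIndex_not_disjoint_le (X : Finset (Site L)) {f : ℕ → ℝ} (hf : ∀ s, 0 ≤ f s) :
    ∑ i ∈ (squareIndex L).filter (fun i => ¬Disjoint i.2 X), f i.1 ≤
      X.card * ∑ s ∈ Finset.Icc 1 L, (s : ℝ) ^ 2 * f s := by
  rw [Finset.sum_filter, squareIndex, Finset.sum_sigma, Finset.mul_sum]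
  refine Finset.sum_le_sum fun s _ => ?_
  rw [← Finset.sum_filter]
  change ∑ _A ∈ (squares L s).filter (fun A => ¬Disjoint A X), f s ≤ _
  rw [Finset.sum_const, nsmul_eq_mul, ← mul_assoc]
  refine mul_le_mul_of_nonneg_right ?_ (hf s)
  exact_mod_cast card_squares_not_disjoint_le s X

/-- The pairs `(s, Z)` whose square `Z` is contained in the enlargement of `squareAt L a x` by
`n - 1` sites on each side; there are none for `n = 0`. -/
noncomputable def nearIndex (a : ℕ) (x : Site L) (n : ℕ) : Finset (Σ _ : ℕ, Finset (Site L)) :=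
  (squareIndex L).filter fun i => squareDist L a x i.2 < n

lemma mem_nearIndex {a : ℕ} {x : Site L} {n : ℕ} {i : Σ _ : ℕ, Finset (Site L)} :
    i ∈ nearIndex a x n ↔ i ∈ squareIndex L ∧ squareDist L a x i.2 < n := Finset.mem_filter

/-- The decay factor `e^{-μl} / (1 + l)` at depth `l = n - δ` (zero if `δ ≥ n`), for a set that reaches
distance `δ` in a region that extends to distance `n`. -/
noncomputable def depthWeight (μ : ℝ) (n δ : ℕ) : ℝ :=
  (1 + ((n - δ : ℕ) : ℝ))⁻¹ * Real.exp (-(μ * (n - δ : ℕ)))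

lemma depthWeight_pos (μ : ℝ) (n δ : ℕ) : 0 < depthWeight μ n δ := by
  unfold depthWeight; positivity

/-- The bound `K s⁻⁶ e^{-μs}` for the local terms of size `s`. -/
noncomputable def termDecay (K μ : ℝ) (s : ℕ) : ℝ := K * ((s : ℝ) ^ 6)⁻¹ * Real.exp (-(μ * s))

/-- A term of size `s` meeting a set at distance `δ` has depth at least `n - δ - s`, and its factor
`e^{-μs}` makes up for the loss `s` in the exponential. -/
lemma termDecay_mul_weight_le {K μ : ℝ} (hK : 0 ≤ K) (hμ : 0 ≤ μ) {s n δ δ' : ℕ} (hs : 1 ≤ s)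
    (h : δ' ≤ δ + s) :
    termDecay K μ s * ((s : ℝ) ^ 2 * depthWeight μ n δ') ≤
      K * Real.exp (-(μ * (n - δ : ℕ))) * (((s : ℝ) ^ 4)⁻¹ * (1 + ((n - δ - s : ℕ) : ℝ))⁻¹) := by
  have hs0 : (s : ℝ) ≠ 0 := by positivity
  have e : termDecay K μ s * ((s : ℝ) ^ 2 * depthWeight μ n δ') =
      K * (Real.exp (-(μ * s)) * Real.exp (-(μ * (n - δ' : ℕ)))) *
        (((s : ℝ) ^ 4)⁻¹ * (1 + ((n - δ' : ℕ) : ℝ))⁻¹) := by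
    unfold termDecay depthWeight
    field_simp
  rw [e, ← Real.exp_add]
  have h1 : ((n - δ : ℕ) : ℝ) ≤ s + (n - δ' : ℕ) := by exact_mod_cast (by omega)
  have h2 : ((n - δ - s : ℕ) : ℝ) ≤ (n - δ' : ℕ) := by exact_mod_cast (by omega)
  gcongr
  nlinarith

open Classical in
/-- The weight `s² e^{-μl} / (1 + l)` is superharmonic for the interaction `K s⁻⁶ e^{-μs}`. -/
lemma sum_termDecay_mul_weight_le {K μ : ℝ} (hK : 0 ≤ K) (hμ : 0 ≤ μ) {a : ℕ} (x : Site L)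
    (n p : ℕ) {X : Finset (Site L)} (hX : X.card ≤ p) :
    ∑ i ∈ (nearIndex a x (n + 1)).filter (fun i => ¬Disjoint i.2 X),
      termDecay K μ i.1 * ((i.1 : ℝ) ^ 2 * depthWeight μ n (squareDist L a x i.2)) ≤
      6 * K * (p * depthWeight μ n (squareDist L a x X)) := by
  set l := n - squareDist L a x X with hl
  let f : ℕ → ℝ := fun s =>
    K * Real.exp (-(μ * l)) * (((s : ℝ) ^ 4)⁻¹ * (1 + ((l - s : ℕ) : ℝ))⁻¹)
  have hf : ∀ s, 0 ≤ f s := fun s => by positivity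
  calc _ ≤ ∑ i ∈ (nearIndex a x (n + 1)).filter (fun i => ¬Disjoint i.2 X), f i.1 := by
        refine Finset.sum_le_sum fun i hi => ?_
        rw [Finset.mem_filter, mem_nearIndex, mem_squareIndex] at hi
        exact termDecay_mul_weight_le hK hμ hi.1.1.1.1 (squareDist_le_add hi.1.1.2 hi.2)
    _ ≤ ∑ i ∈ (squareIndex L).filter (fun i => ¬Disjoint i.2 X), f i.1 :=
        Finset.sum_le_sum_of_subset_of_nonneg
          (Finset.filter_subset_filter _ (Finset.filter_subset _ _)) fun i _ _ => hf i.1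
    _ ≤ X.card * ∑ s ∈ Finset.Icc 1 L, (s : ℝ) ^ 2 * f s := sum_squareIndex_not_disjoint_le X hf
    _ = X.card * (K * Real.exp (-(μ * l)) *
          ∑ s ∈ Finset.Icc 1 L, ((s : ℝ) ^ 2)⁻¹ * (1 + ((l - s : ℕ) : ℝ))⁻¹) := by
        rw [Finset.mul_sum (a := K * Real.exp (-(μ * l)))]
        congr 1
        refine Finset.sum_congr rfl fun s hs => ?_
        have : (s : ℝ) ≠ 0 := by
          have := (Finset.mem_Icc.1 hs).1
          positivity
        simp only [f]
        field_simp
    _ ≤ p * (K * Real.exp (-(μ * l)) * (6 * (1 + (l : ℝ))⁻¹)) := by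
        gcongr
        exact sum_inv_sq_mul_inv_le l L
    _ = _ := by
        rw [depthWeight, ← hl]; ring

open Classical in
lemma sum_termDecay_le {K μ : ℝ} (hK : 0 ≤ K) (hμ : 0 ≤ μ) {a : ℕ} (x : Site L)
    (n p : ℕ) {X : Finset (Site L)} (hX : X.card ≤ p) :
    ∑ i ∈ (nearIndex a x n).filter (fun i => ¬Disjoint i.2 X), termDecay K μ i.1 ≤
      6 * K * p := by
  have hf : ∀ s, 0 ≤ termDecay K μ s := fun s => by unfold termDecay; positivity
  calc _ ≤ ∑ i ∈ (squareIndex L).filter (fun i => ¬Disjoint i.2 X), termDecay K μ i.1 :=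
        Finset.sum_le_sum_of_subset_of_nonneg
          (Finset.filter_subset_filter _ (Finset.filter_subset _ _)) fun i _ _ => hf i.1
    _ ≤ X.card * ∑ s ∈ Finset.Icc 1 L, (s : ℝ) ^ 2 * termDecay K μ s :=
        sum_squareIndex_not_disjoint_le X hf
    _ ≤ p * ∑ s ∈ Finset.Icc 1 L, K * ((s : ℝ) ^ 2)⁻¹ := by
        refine mul_le_mul (by exact_mod_cast hX) (Finset.sum_le_sum fun s hs => ?_)
          (Finset.sum_nonneg fun s _ => mul_nonneg (by positivity) (hf s)) (Nat.cast_nonneg _)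
        have hs1 : (1 : ℝ) ≤ s := by exact_mod_cast (Finset.mem_Icc.1 hs).1
        have h1 : Real.exp (-(μ * s)) ≤ 1 := Real.exp_le_one_iff.2 (by nlinarith)
        have h2 : ((s : ℝ) ^ 4)⁻¹ ≤ ((s : ℝ) ^ 2)⁻¹ := by
          gcongr
          norm_num
        calc (s : ℝ) ^ 2 * termDecay K μ s = K * ((s : ℝ) ^ 4)⁻¹ * Real.exp (-(μ * s)) := by
              unfold termDecay; field_simp
          _ ≤ K * ((s : ℝ) ^ 2)⁻¹ * 1 := by gcongr
          _ = _ := mul_one _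
    _ ≤ p * (K * 2) := by
        rw [← Finset.mul_sum]
        gcongr
        exact sum_inv_sq_le_two L
    _ ≤ _ := by nlinarith [mul_nonneg hK (Nat.cast_nonneg (α := ℝ) p)]

variable {d : Site L → ℕ}

/-- The part of the generator `∑ T r A` formed by the terms of `nearIndex a x n`. -/
noncomputable def nearGenerator (T : ℕ → Finset (Site L) → QuditOp d) (a : ℕ) (x : Site L)
    (n : ℕ) : QuditOp d := ∑ i ∈ nearIndex a x n, T i.1 i.2

/-- The effect on the second-order remainder of the generator terms that reach distance exactly `n`
from the support of `V`. -/
lemma norm_remainder_nearGenerator_succ_sub_le {K μ : ℝ} (hK : 0 ≤ K) (hμ : 0 ≤ μ)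
    {T : ℕ → Finset (Site L) → QuditOp d} (hskew : ∀ r A, star (T r A) = -T r A)
    (hT : ∀ i ∈ squareIndex L, ‖T i.1 i.2‖ ≤ termDecay K μ i.1)
    (hsupp : ∀ i ∈ squareIndex L, T i.1 i.2 ∈ localAlgebra d i.2)
    {a : ℕ} (ha : 1 ≤ a) (x : Site L) {V : QuditOp d} (hV : V ∈ localAlgebra d (squareAt L a x))
    (n : ℕ) :
    ‖remainder (nearGenerator T a x (n + 1)) V - remainder (nearGenerator T a x n) V‖ ≤
      6 * ‖V‖ * (2 * (6 * K) + (Real.exp (2 * (6 * K)) - 1)) * (6 * K) * (a ^ 2 : ℕ) *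
        ((a ^ 2 : ℕ) * depthWeight μ n 0) := by
  classical
  have hsub : ∀ {n}, ∀ i ∈ nearIndex a x n, i ∈ squareIndex L := fun i hi =>
    (mem_nearIndex.1 hi).1
  have hone : ∀ i ∈ nearIndex a x (n + 1), (1 : ℝ) ≤ (i.1 : ℝ) ^ 2 := fun i hi =>
    one_le_pow₀ (by exact_mod_cast (mem_squareIndex.1 (hsub i hi)).1.1)
  refine norm_remainder_sub_remainder_le (I := nearIndex a x (n + 1)) (I' := nearIndex a x n)
    (S := fun i => T i.1 i.2) (k := fun i => termDecay K μ i.1)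
    (h := fun i => (i.1 : ℝ) ^ 2 * depthWeight μ n (squareDist L a x i.2))
    (m := fun i => (i.1 : ℝ) ^ 2)
    (N := fun i => (nearIndex a x (n + 1)).filter fun j => ¬Disjoint j.2 i.2)
    (M := (nearIndex a x (n + 1)).filter fun j => ¬Disjoint j.2 (squareAt L a x))
    ?_ (fun i _ => hskew _ _) (fun i hi => hT i (hsub i hi)) ?_ hone ?_
    (fun i _ => Finset.filter_subset _ _) ?_ (by positivity) ?_ ?_ (Finset.filter_subset _ _)
    ?_ ?_ ?_ ?_ ?_
  · intro i hi
    rw [mem_nearIndex] at hi ⊢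
    exact ⟨hi.1, by omega⟩
  · intro i hi
    exact mul_pos (by linarith [hone i hi]) (depthWeight_pos _ _ _)
  · -- a term added in this step has distance `n`, hence weight `s²`
    intro i hi hi'
    rw [mem_nearIndex] at hi hi'
    have : n - squareDist L a x i.2 = 0 :=
      Nat.sub_eq_zero_of_le (not_lt.1 fun h => hi' ⟨hi.1, h⟩)
    simp [depthWeight, this]
  · intro i hi j hj hij
    have hd : Disjoint j.2 i.2 := by
      by_contra h
      exact hij (Finset.mem_filter.2 ⟨hj, h⟩)
    exact commute_of_disjoint hd (hsupp j (hsub j hj)) (hsupp i (hsub i hi))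
  · intro i hi
    have := sum_termDecay_mul_weight_le hK hμ (a := a) x n (i.1 ^ 2)
      (card_le_sq_of_mem_squareIndex (hsub i hi))
    push_cast at this
    exact this
  · intro i hi
    have := sum_termDecay_le hK hμ (a := a) x (n + 1) (i.1 ^ 2)
      (card_le_sq_of_mem_squareIndex (hsub i hi))
    push_cast at this
    exact this
  · intro i hi hiM
    have hd : Disjoint i.2 (squareAt L a x) := by
      by_contra h
      exact hiM (Finset.mem_filter.2 ⟨hi, h⟩)
    exact commute_of_disjoint hd (hsupp i (hsub i hi)) hV
  · exact_mod_cast Nat.one_le_pow _ _ ha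
  · exact mul_nonneg (by positivity) (depthWeight_pos _ _ _).le
  · exact sum_termDecay_le hK hμ x (n + 1) (a ^ 2) (card_squareAt_le _ _)
  · have := sum_termDecay_mul_weight_le hK hμ (a := a) x n (a ^ 2) (card_squareAt_le a x)
    rwa [squareDist_squareAt] at this

lemma nearGenerator_zero (T : ℕ → Finset (Site L) → QuditOp d) (a : ℕ) (x : Site L) :
    nearGenerator T a x 0 = 0 := by simp [nearGenerator, nearIndex]

lemma nearGenerator_eq_sum (T : ℕ → Finset (Site L) → QuditOp d) {a n : ℕ} (x : Site L)
    (h : L ≤ a + 2 * n) :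
    nearGenerator T a x (n + 1) = ∑ i ∈ squareIndex L, T i.1 i.2 := by
  rw [nearGenerator, nearIndex, Finset.filter_true_of_mem]
  intro i _
  rw [Nat.lt_succ_iff, squareDist_le_iff, enlargedSquare_eq_univ x h]
  exact Finset.subset_univ _

lemma nearGenerator_mem_localAlgebra {T : ℕ → Finset (Site L) → QuditOp d}
    (hsupp : ∀ i ∈ squareIndex L, T i.1 i.2 ∈ localAlgebra d i.2) (a : ℕ) (x : Site L) {n m : ℕ}
    (hnm : n ≤ m + 1) :
    nearGenerator T a x n ∈ localAlgebra d (enlargedSquare L a x m) := by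
  refine sum_mem fun i hi => ?_
  rw [mem_nearIndex] at hi
  exact localAlgebra_mono (squareDist_le_iff.1 (by omega)) (hsupp i hi.1)

end Local

/-! ### Skew-adjoint local terms -/

section SkewPart

variable {𝔸 : Type*} [NormedRing 𝔸] [StarRing 𝔸] [CStarRing 𝔸] [NormedAlgebra ℂ 𝔸] [StarModule ℂ 𝔸]

/-- The skew-adjoint part `(X - X*) / 2`. -/
noncomputable def skewPart (X : 𝔸) : 𝔸 := (1 / 2 : ℂ) • (X - star X)

lemma star_skewPart (X : 𝔸) : star (skewPart X) = -skewPart X := by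
  rw [skewPart, star_smul, star_sub, star_star, ← smul_neg, neg_sub]
  norm_num

lemma norm_skewPart_le (X : 𝔸) : ‖skewPart X‖ ≤ ‖X‖ := by
  have := norm_sub_le X (star X)
  rw [norm_star] at this
  rw [skewPart, norm_smul]
  norm_num
  linarith

lemma sum_skewPart {ι : Type*} (s : Finset ι) (X : ι → 𝔸) :
    skewPart (∑ i ∈ s, X i) = ∑ i ∈ s, skewPart (X i) := by
  simp only [skewPart]
  rw [← Finset.smul_sum, Finset.sum_sub_distrib, star_sum]

lemma skewPart_of_skew {X : 𝔸} (hX : star X = -X) : skewPart X = X := by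
  rw [skewPart, hX, sub_neg_eq_add, ← two_smul ℂ X, smul_smul]
  norm_num

end SkewPart

/-! ### The local decomposition of the second-order remainder -/

section Decomposition
variable {L : ℕ} [NeZero L]

open Classical in
/-- The lower left corner of the `a × a` square `A`; a choice for `a = L`, when every site is one, and
`0` if `A` is not such a square. -/
noncomputable def corner (a : ℕ) (A : Finset (Site L)) : Site L :=
  if h : ∃ x, squareAt L a x = A then h.choose else 0

lemma squareAt_corner {a : ℕ} {A : Finset (Site L)} (hA : A ∈ squares L a) :
    squareAt L a (corner a A) = A := by
  have h := (mem_squares.1 hA).2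
  rw [corner, dif_pos h]
  exact h.choose_spec

/-- All `((a, A), n)` with `A ∈ 𝒮(a)` and `n` up to the first value at which enlarging `A` by `n` sites
on each side gives the whole lattice, that is, `a + 2n ≥ L`. -/
def layerIndex (L : ℕ) [NeZero L] : Finset (Σ _ : (Σ _ : ℕ, Finset (Site L)), ℕ) :=
  (squareIndex L).sigma fun i => Finset.range ((L - i.1 + 1) / 2 + 1)

lemma mem_layerIndex {p : Σ _ : (Σ _ : ℕ, Finset (Site L)), ℕ} :
    p ∈ layerIndex L ↔ p.1 ∈ squareIndex L ∧ p.2 ≤ (L - p.1.1 + 1) / 2 := by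
  rw [layerIndex, Finset.mem_sigma, Finset.mem_range, Nat.lt_succ_iff]

/-- The square that supports the layer `((a, A), n)`: `A` enlarged by `n` sites on each side, together
with its size, which is `L` if the enlargement is the whole lattice. -/
noncomputable def layerSquare (p : Σ _ : (Σ _ : ℕ, Finset (Site L)), ℕ) :
    Σ _ : ℕ, Finset (Site L) :=
  ⟨min (p.1.1 + 2 * p.2) L, enlargedSquare L p.1.1 (corner p.1.1 p.1.2) p.2⟩

lemma layerSquare_mem {p : Σ _ : (Σ _ : ℕ, Finset (Site L)), ℕ} (hp : p ∈ layerIndex L) :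
    layerSquare p ∈ squareIndex L := by
  have h := (mem_squareIndex.1 (mem_layerIndex.1 hp).1).1
  have hL : 0 < L := Nat.pos_of_ne_zero (NeZero.ne L)
  have h1 : 1 ≤ min (p.1.1 + 2 * p.2) L := by omega
  have h2 : min (p.1.1 + 2 * p.2) L ≤ L := min_le_right _ _
  refine mem_squareIndex.2 ⟨⟨h1, h2⟩, mem_squares.2 ⟨⟨h1, h2⟩, ?_⟩⟩
  simp only [layerSquare]
  rcases le_total (p.1.1 + 2 * p.2) L with h' | h'
  · rw [min_eq_left h']; exact ⟨_, rfl⟩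
  · rw [min_eq_right h', enlargedSquare_eq_univ _ h']
    exact ⟨0, squareAt_eq_univ le_rfl _⟩

lemma card_squares_le (r : ℕ) : (squares L r).card ≤ L ^ 2 := by
  unfold squares
  split_ifs
  · refine Finset.card_image_le.trans ?_
    rw [Finset.card_univ, Fintype.card_prod, ZMod.card, sq]
  · simp

open Classical in
/-- The layers supported on a given square of size `r` have total weight at most `12 r`. For `r < L`
the weights are even bounded; on the whole lattice there are `L²` layers for each size `a`, and the
factor `1 / (1 + n)` reduces `L²` to `L`. -/
lemma sum_layer_fiber_le {r : ℕ} (C : Finset (Site L)) :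
    ∑ p ∈ (layerIndex L).filter (fun p => layerSquare p = ⟨r, C⟩),
      ((p.1.1 : ℝ) ^ 2)⁻¹ * (1 + (p.2 : ℝ))⁻¹ ≤ 12 * r := by
  set F := (layerIndex L).filter (fun p => layerSquare p = ⟨r, C⟩) with hF
  have hmem : ∀ p ∈ F, (p.1 ∈ squareIndex L ∧ p.2 ≤ (L - p.1.1 + 1) / 2) ∧
      min (p.1.1 + 2 * p.2) L = r ∧ enlargedSquare L p.1.1 (corner p.1.1 p.1.2) p.2 = C := by
    intro p hp
    rw [hF, Finset.mem_filter, mem_layerIndex] at hp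
    refine ⟨hp.1, congrArg Sigma.fst hp.2, ?_⟩
    have := hp.2
    rw [layerSquare, Sigma.mk.injEq] at this
    exact eq_of_heq this.2
  rcases Finset.eq_empty_or_nonempty F with h0 | ⟨p₀, hp₀⟩
  · rw [h0, Finset.sum_empty]; positivity
  have hL : 0 < L := Nat.pos_of_ne_zero (NeZero.ne L)
  have hr : 1 ≤ r ∧ r ≤ L := by
    have := hmem p₀ hp₀
    have h1 := (mem_squareIndex.1 this.1.1).1
    have h2 := this.2.1
    omega
  have hr1 : (1 : ℝ) ≤ r := by exact_mod_cast hr.1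
  rcases hr.2.lt_or_eq with hrL | hrL
  · -- a square smaller than the lattice arises from at most one square of each size
    have hinj : Set.InjOn (fun p : (Σ _ : (Σ _ : ℕ, Finset (Site L)), ℕ) => p.1.1) F := by
      rintro ⟨⟨a, A⟩, n⟩ hp ⟨⟨a', A'⟩, n'⟩ hp' (rfl : a = a')
      have h := hmem _ hp
      have h' := hmem _ hp'
      dsimp only at h h'
      obtain rfl : n = n' := by omega
      have e : a + 2 * n = r := by omega
      have hc : corner a A = corner a A' := by
        have := h.2.2.trans h'.2.2.symm
        rw [enlargedSquare, enlargedSquare, e] at this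
        have := squareAt_injective hr.1 hrL this
        simpa [Prod.ext_iff] using this
      obtain rfl : A = A' := (squareAt_corner (mem_squareIndex.1 h.1.1).2).symm.trans
        ((congrArg (squareAt L a) hc).trans (squareAt_corner (mem_squareIndex.1 h'.1.1).2))
      rfl
    calc _ ≤ ∑ p ∈ F, ((p.1.1 : ℝ) ^ 2)⁻¹ := by
          refine Finset.sum_le_sum fun p _ => mul_le_of_le_one_right (by positivity)
            (inv_le_one_of_one_le₀ ?_)
          linarith [Nat.cast_nonneg (α := ℝ) p.2]
      _ = ∑ a ∈ (F.image (fun p => p.1.1) : Finset ℕ), ((a : ℝ) ^ 2)⁻¹ :=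
          (Finset.sum_image (f := fun a : ℕ => ((a : ℝ) ^ 2)⁻¹) hinj).symm
      _ ≤ ∑ a ∈ Finset.Icc 1 L, ((a : ℝ) ^ 2)⁻¹ := by
          refine Finset.sum_le_sum_of_subset_of_nonneg (fun a ha => ?_) fun _ _ _ => by positivity
          obtain ⟨p, hp, rfl⟩ := Finset.mem_image.1 ha
          exact Finset.mem_Icc.2 (mem_squareIndex.1 (hmem p hp).1.1).1
      _ ≤ 2 := sum_inv_sq_le_two L
      _ ≤ _ := by linarith
  · -- the lattice itself arises from every square, but from its last layer only
    have hinj : Set.InjOn (fun p : (Σ _ : (Σ _ : ℕ, Finset (Site L)), ℕ) => p.1) F := by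
      rintro ⟨i, n⟩ hp ⟨i', n'⟩ hp' (rfl : i = i')
      have h := hmem _ hp
      have h' := hmem _ hp'
      have := (mem_squareIndex.1 h.1.1).1
      dsimp only at h h'
      obtain rfl : n = n' := by omega
      rfl
    calc _ ≤ ∑ p ∈ F, ((p.1.1 : ℝ) ^ 2)⁻¹ * (2 * (1 + ((L - p.1.1 : ℕ) : ℝ))⁻¹) := by
          refine Finset.sum_le_sum fun p hp => mul_le_mul_of_nonneg_left ?_ (by positivity)
          have h := (hmem p hp).2.1
          have h2 : ((L - p.1.1 : ℕ) : ℝ) ≤ 2 * p.2 := by exact_mod_cast (by omega)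
          rw [← div_eq_mul_inv, inv_eq_one_div, div_le_div_iff₀ (by positivity) (by positivity)]
          linarith
      _ = ∑ i ∈ F.image (fun p => p.1),
            ((i.1 : ℝ) ^ 2)⁻¹ * (2 * (1 + ((L - i.1 : ℕ) : ℝ))⁻¹) :=
          (Finset.sum_image (f := fun i : (Σ _ : ℕ, Finset (Site L)) =>
            ((i.1 : ℝ) ^ 2)⁻¹ * (2 * (1 + ((L - i.1 : ℕ) : ℝ))⁻¹)) hinj).symm
      _ ≤ ∑ i ∈ squareIndex L, ((i.1 : ℝ) ^ 2)⁻¹ * (2 * (1 + ((L - i.1 : ℕ) : ℝ))⁻¹) := by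
          refine Finset.sum_le_sum_of_subset_of_nonneg (fun i hi => ?_) fun _ _ _ => by positivity
          obtain ⟨p, hp, rfl⟩ := Finset.mem_image.1 hi
          exact (hmem p hp).1.1
      _ = ∑ a ∈ Finset.Icc 1 L, ((squares L a).card : ℝ) *
            (((a : ℝ) ^ 2)⁻¹ * (2 * (1 + ((L - a : ℕ) : ℝ))⁻¹)) := by
          rw [squareIndex, Finset.sum_sigma]
          refine Finset.sum_congr rfl fun a _ => ?_
          dsimp only
          rw [Finset.sum_const, nsmul_eq_mul]
      _ ≤ ∑ a ∈ Finset.Icc 1 L, (L : ℝ) ^ 2 *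
            (((a : ℝ) ^ 2)⁻¹ * (2 * (1 + ((L - a : ℕ) : ℝ))⁻¹)) := by
          refine Finset.sum_le_sum fun a _ => mul_le_mul_of_nonneg_right ?_ (by positivity)
          exact_mod_cast card_squares_le a
      _ = 2 * (L : ℝ) ^ 2 *
            ∑ a ∈ Finset.Icc 1 L, ((a : ℝ) ^ 2)⁻¹ * (1 + ((L - a : ℕ) : ℝ))⁻¹ := by
          rw [Finset.mul_sum]
          exact Finset.sum_congr rfl fun a _ => by ring
      _ ≤ 2 * (L : ℝ) ^ 2 * (6 * (1 + (L : ℝ))⁻¹) := by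
          gcongr
          exact sum_inv_sq_mul_inv_le L L
      _ = 12 * L * (L / (1 + L)) := by ring
      _ ≤ 12 * L * 1 := by
          gcongr
          rw [div_le_one (by positivity)]
          linarith
      _ = 12 * r := by rw [hrL, mul_one]

variable {d : Site L → ℕ}

lemma isLocalDecomposition_iff {V : QuditOp d} {T : ℕ → Finset (Site L) → QuditOp d} :
    IsLocalDecomposition V T ↔ (∀ i ∈ squareIndex L, T i.1 i.2 ∈ localAlgebra d i.2) ∧
      V = ∑ i ∈ squareIndex L, T i.1 i.2 := by
  rw [IsLocalDecomposition, squareIndex, Finset.sum_sigma]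
  refine and_congr_left' ⟨fun h i hi => ?_, fun h r hr A hA => ?_⟩
  · have := mem_squareIndex.1 hi
    exact supportedOn_iff.1 (h i.1 this.1.1 i.2 this.2)
  · exact supportedOn_iff.2 (h ⟨r, A⟩ (mem_squareIndex.2 ⟨(mem_squares.1 hA).1, hA⟩))

lemma IsDecayingFamily.nonneg {T : ℕ → Finset (Site L) → QuditOp d} {J μ α : ℝ}
    (h : IsDecayingFamily T J μ α) : 0 ≤ J := by
  have hL : 1 ≤ L := Nat.one_le_iff_ne_zero.2 (NeZero.ne L)
  refine le_trans ?_ (h 1 le_rfl (squareAt L 1 0) (mem_squares.2 ⟨⟨le_rfl, hL⟩, 0, rfl⟩))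
  positivity

lemma IsDecayingFamily.norm_le {T : ℕ → Finset (Site L) → QuditOp d} {J μ α : ℝ}
    (h : IsDecayingFamily T J μ α) (hα : 6 ≤ α) {i : Σ _ : ℕ, Finset (Site L)}
    (hi : i ∈ squareIndex L) : ‖T i.1 i.2‖ ≤ termDecay J μ i.1 := by
  rw [mem_squareIndex] at hi
  have h1 : (1 : ℝ) ≤ i.1 := by exact_mod_cast hi.1.1
  have h2 : (i.1 : ℝ) ^ 6 ≤ (i.1 : ℝ) ^ α := by
    rw [← Real.rpow_natCast]
    exact Real.rpow_le_rpow_of_exponent_le h1 (by exact_mod_cast hα)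
  have h3 := h i.1 hi.1.1 i.2 hi.2
  rw [termDecay, Real.exp_neg, mul_assoc, ← mul_inv, ← div_eq_mul_inv, le_div_iff₀ (by positivity),
    ← mul_assoc]
  refine le_trans ?_ h3
  gcongr

/-- The terms in the decomposition of a skew-adjoint operator can be taken skew-adjoint, so that all
partial sums generate unitary evolutions. -/
lemma IsDecaying.exists_skew {S : QuditOp d} {K μ α : ℝ} (hS : star S = -S)
    (h : IsDecaying S K μ α) :
    ∃ T : ℕ → Finset (Site L) → QuditOp d, IsLocalDecomposition S T ∧ IsDecayingFamily T K μ α ∧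
      ∀ r A, star (T r A) = -T r A := by
  obtain ⟨T, hT, hd⟩ := h
  rw [isLocalDecomposition_iff] at hT
  refine ⟨fun r A => skewPart (T r A), isLocalDecomposition_iff.2
    ⟨fun i hi => SMulMemClass.smul_mem _ (sub_mem (hT.1 i hi) (star_mem (hT.1 i hi))), ?_⟩,
    fun r hr A hA => ?_, fun r A => star_skewPart _⟩
  · rw [← sum_skewPart, ← hT.2, skewPart_of_skew hS]
  · refine le_trans ?_ (hd r hr A hA)
    have := norm_skewPart_le (T r A)
    gcongr

lemma remainder_zero_left (V : QuditOp d) : remainder 0 V = 0 := by simp [remainder]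

lemma remainder_sum {ι : Type*} (s : Finset ι) (S : QuditOp d) (V : ι → QuditOp d) :
    remainder S (∑ i ∈ s, V i) = ∑ i ∈ s, remainder S (V i) := by
  simp only [remainder, Finset.mul_sum, Finset.sum_mul, Finset.sum_sub_distrib]

/-- The change of the remainder of the term `W a A` when the generator terms at distance exactly `n`
from `A` are added to those at smaller distance. -/
noncomputable def layerTerm (T : ℕ → Finset (Site L) → QuditOp d)
    (W : ℕ → Finset (Site L) → QuditOp d) (p : Σ _ : (Σ _ : ℕ, Finset (Site L)), ℕ) : QuditOp d :=
  remainder (nearGenerator T p.1.1 (corner p.1.1 p.1.2) (p.2 + 1)) (W p.1.1 p.1.2) -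
    remainder (nearGenerator T p.1.1 (corner p.1.1 p.1.2) p.2) (W p.1.1 p.1.2)

lemma sum_layerTerm (T W : ℕ → Finset (Site L) → QuditOp d) :
    ∑ p ∈ layerIndex L, layerTerm T W p =
      remainder (∑ i ∈ squareIndex L, T i.1 i.2) (∑ i ∈ squareIndex L, W i.1 i.2) := by
  rw [remainder_sum, layerIndex, Finset.sum_sigma]
  refine Finset.sum_congr rfl fun i hi => ?_
  simp only [layerTerm]
  rw [Finset.sum_range_sub (fun n => remainder (nearGenerator T i.1 (corner i.1 i.2) n)
    (W i.1 i.2)), nearGenerator_zero, remainder_zero_left, sub_zero, nearGenerator_eq_sum]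
  have := (mem_squareIndex.1 hi).1
  omega

lemma layerTerm_mem_localAlgebra {T W : ℕ → Finset (Site L) → QuditOp d}
    (hT : ∀ i ∈ squareIndex L, T i.1 i.2 ∈ localAlgebra d i.2)
    (hW : ∀ i ∈ squareIndex L, W i.1 i.2 ∈ localAlgebra d i.2)
    {p : Σ _ : (Σ _ : ℕ, Finset (Site L)), ℕ} (hp : p ∈ layerIndex L) :
    layerTerm T W p ∈ localAlgebra d (layerSquare p).2 := by
  have hi := (mem_layerIndex.1 hp).1
  have hV : W p.1.1 p.1.2 ∈ localAlgebra d (layerSquare p).2 := by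
    refine localAlgebra_mono ?_ (hW p.1 hi)
    rw [← squareAt_corner (mem_squareIndex.1 hi).2, ← enlargedSquare_zero]
    exact enlargedSquare_mono _ _ (Nat.zero_le _)
  exact sub_mem
    (remainder_mem_localAlgebra (nearGenerator_mem_localAlgebra hT _ _ le_rfl) hV)
    (remainder_mem_localAlgebra (nearGenerator_mem_localAlgebra hT _ _ (Nat.le_succ _)) hV)

lemma norm_layerTerm_le {K₀ K J μ : ℝ} (hK : 0 ≤ K) (hKK : K ≤ K₀) (hJ : 0 ≤ J) (hμ : 0 ≤ μ)
    {T W : ℕ → Finset (Site L) → QuditOp d} (hskew : ∀ r A, star (T r A) = -T r A)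
    (hT : ∀ i ∈ squareIndex L, T i.1 i.2 ∈ localAlgebra d i.2)
    (hTn : ∀ i ∈ squareIndex L, ‖T i.1 i.2‖ ≤ termDecay K μ i.1)
    (hW : ∀ i ∈ squareIndex L, W i.1 i.2 ∈ localAlgebra d i.2)
    (hWn : ∀ i ∈ squareIndex L, ‖W i.1 i.2‖ ≤ termDecay J μ i.1)
    {p : Σ _ : (Σ _ : ℕ, Finset (Site L)), ℕ} (hp : p ∈ layerIndex L) :
    ‖layerTerm T W p‖ ≤ 432 * (1 + Real.exp (12 * K₀)) * J * K ^ 2 *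
      Real.exp (-(μ / 2 * (layerSquare p).1)) * (((p.1.1 : ℝ) ^ 2)⁻¹ * (1 + (p.2 : ℝ))⁻¹) := by
  obtain ⟨⟨a, A⟩, n⟩ := p
  have hi := (mem_layerIndex.1 hp).1
  have hi' := mem_squareIndex.1 hi
  dsimp only at hi hi'
  have hV : W a A ∈ localAlgebra d (squareAt L a (corner a A)) := by
    rw [squareAt_corner hi'.2]; exact hW ⟨a, A⟩ hi
  have ha : (0 : ℝ) < a := by exact_mod_cast hi'.1.1
  have hexp : Real.exp (2 * (6 * K)) - 1 ≤ 12 * K * Real.exp (12 * K₀) := by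
    have h1 : Real.exp (12 * K) ≤ Real.exp (12 * K₀) := Real.exp_le_exp.2 (by linarith)
    -- `eˣ - 1 ≤ x eˣ` is `1 - x ≤ e⁻ˣ` multiplied by `eˣ`
    have h2 := Real.add_one_le_exp (-(12 * K))
    have h3 : Real.exp (-(12 * K)) * Real.exp (12 * K) = 1 := by rw [← Real.exp_add]; simp
    have h4 := mul_le_mul_of_nonneg_right h2 (Real.exp_pos (12 * K)).le
    have h5 : 12 * K * Real.exp (12 * K) ≤ 12 * K * Real.exp (12 * K₀) := by gcongr
    rw [show 2 * (6 * K) = 12 * K by ring]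
    linarith
  have hWa : ‖W a A‖ ≤ termDecay J μ a := hWn ⟨a, A⟩ hi
  have hdecay : Real.exp (-(μ * a)) * Real.exp (-(μ * n)) ≤
      Real.exp (-(μ / 2 * (min (a + 2 * n) L : ℕ))) := by
    rw [← Real.exp_add]
    refine Real.exp_le_exp.2 ?_
    have h1 : ((min (a + 2 * n) L : ℕ) : ℝ) ≤ a + 2 * n := by exact_mod_cast min_le_left _ _
    have h2 := mul_le_mul_of_nonneg_left h1 (by linarith : (0 : ℝ) ≤ μ / 2)
    have h3 : 0 ≤ μ * a := by positivity
    linarith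
  have hw := (depthWeight_pos μ n 0).le
  calc _ ≤ 6 * ‖W a A‖ * (2 * (6 * K) + (Real.exp (2 * (6 * K)) - 1)) * (6 * K) * (a ^ 2 : ℕ) *
        ((a ^ 2 : ℕ) * depthWeight μ n 0) :=
        norm_remainder_nearGenerator_succ_sub_le hK hμ hskew hTn hT hi'.1.1 _ hV n
    _ ≤ 6 * termDecay J μ a * (2 * (6 * K) + 12 * K * Real.exp (12 * K₀)) * (6 * K) *
        (a ^ 2 : ℕ) * ((a ^ 2 : ℕ) * depthWeight μ n 0) := by
        have h0 : 0 ≤ Real.exp (2 * (6 * K)) - 1 := by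
          have := Real.one_le_exp (x := 2 * (6 * K)) (by positivity)
          linarith
        have h1 := (norm_nonneg _).trans hWa
        gcongr
    _ = 432 * (1 + Real.exp (12 * K₀)) * J * K ^ 2 *
        (Real.exp (-(μ * a)) * Real.exp (-(μ * n))) * (((a : ℝ) ^ 2)⁻¹ * (1 + (n : ℝ))⁻¹) := by
        unfold termDecay depthWeight
        push_cast [Nat.sub_zero]
        field_simp
        ring
    _ ≤ _ := by
        simp only [layerSquare]
        gcongr

end Decomposition

theorem mainTheorem4 (K₀ : ℝ) :
    ∃ c : ℝ, 0 < c ∧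
      ∀ (L : ℕ) [NeZero L] (d : Site L → ℕ) (μ α β J K : ℝ) (S V : QuditOp d),
        0 ≤ μ → 6 ≤ α → 6 ≤ β → K ≤ K₀ →
        star S = -S →
        IsDecaying S K μ α →
        IsDecaying V J μ β →
        IsDecaying (secondOrder S V) (c * J * K ^ 2) (μ / 2) (-1) := by
  classical
  refine ⟨12 * (432 * (1 + Real.exp (12 * K₀))), by positivity, ?_⟩
  intro L _ d μ α β J K S V hμ hα hβ hKK hS hSd hVd
  obtain ⟨T, hT, hTd, hskew⟩ := hSd.exists_skew hS
  obtain ⟨W, hW, hWd⟩ := hVd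
  rw [isLocalDecomposition_iff] at hT hW
  have hK := hTd.nonneg
  have hJ := hWd.nonneg
  refine ⟨fun r C => ∑ p ∈ (layerIndex L).filter (fun p => layerSquare p = ⟨r, C⟩),
    layerTerm T W p, isLocalDecomposition_iff.2 ⟨fun i _ => ?_, ?_⟩, fun r hr C hC => ?_⟩
  · refine sum_mem fun p hp => ?_
    have hp := Finset.mem_filter.1 hp
    have := layerTerm_mem_localAlgebra hT.1 hW.1 hp.1
    rwa [hp.2] at this
  · rw [show secondOrder S V = remainder S V from rfl]
    nth_rw 1 [hT.2, hW.2]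
    rw [← sum_layerTerm]
    exact (Finset.sum_fiberwise_of_maps_to (fun p hp => layerSquare_mem hp) _).symm
  · have hr0 : (0 : ℝ) < r := by exact_mod_cast hr
    set D := 432 * (1 + Real.exp (12 * K₀)) * J * K ^ 2 * Real.exp (-(μ / 2 * r)) with hD
    have hbound : ‖∑ p ∈ (layerIndex L).filter (fun p => layerSquare p = ⟨r, C⟩),
        layerTerm T W p‖ ≤ D * (12 * r) := by
      calc _ ≤ ∑ p ∈ (layerIndex L).filter (fun p => layerSquare p = ⟨r, C⟩),
            D * (((p.1.1 : ℝ) ^ 2)⁻¹ * (1 + (p.2 : ℝ))⁻¹) := by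
            refine (norm_sum_le _ _).trans (Finset.sum_le_sum fun p hp => ?_)
            rw [Finset.mem_filter] at hp
            have := norm_layerTerm_le hK hKK hJ hμ hskew hT.1 (fun i hi => hTd.norm_le hα hi)
              hW.1 (fun i hi => hWd.norm_le hβ hi) hp.1
            rwa [hp.2] at this
        _ = D * ∑ p ∈ (layerIndex L).filter (fun p => layerSquare p = ⟨r, C⟩),
            (((p.1.1 : ℝ) ^ 2)⁻¹ * (1 + (p.2 : ℝ))⁻¹) := by rw [Finset.mul_sum]
        _ ≤ D * (12 * r) := by
            gcongr
            exact sum_layer_fiber_le C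
    calc _ ≤ D * (12 * r) * (r : ℝ) ^ (-1 : ℝ) * Real.exp (μ / 2 * r) := by gcongr
      _ = 12 * (432 * (1 + Real.exp (12 * K₀))) * J * K ^ 2 *
          (Real.exp (-(μ / 2 * r)) * Real.exp (μ / 2 * r)) := by
          rw [Real.rpow_neg_one, hD]
          field_simp
      _ = _ := by rw [← Real.exp_add, neg_add_cancel, Real.exp_zero, mul_one]
      _ ≤ _ := le_rfl
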